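/- Let $(x,y)=x_1y_1+x_2y_2$ be the standard complex bilinear form on $\mathbb{C}^2$, and let $m,n\ge 1$ be integers. A configuration $\mathcal A$ of type $(m,1^n)$ consists of pairwise non-collinear vectors $\alpha_0,\dots,\alpha_n\in\mathbb{C}^2$ with $(\alpha_i,\alpha_i)\neq 0$ and multiplicities $m_0=m$, $m_1=\dots=m_n=1$. A polynomial $p\in\mathbb{C}[x_1,x_2]$ is quasi-invariant with respect to $\mathcal A$ if, for all $0\le i\le n$ and $1\le s\le m_i$, the polynomial $\partial_{\alpha_i}^{2s-1}p$ vanishes on the line $(\alpha_i,x)=0$, where $\partial_{\alpha}=(\alpha,\partial/\partial x)$. Let $P_{\mathcal A}(t)=\sum_{k\ge 0} b_k t^k$, where $b_k$ is the dimension of the space of quasi-invariants that are homogeneous of degree $k$. The configuration $\mathcal A$ is called Gorenstein if $P_{\mathcal A}$ is a rational function with $P_{\mathcal A}(t^{-1})=t^{M}P_{\mathcal A}(t)$ for some $M\in\mathbb{Z}$. Two configurations are equivalent if, up to a renumbering preserving multiplicities, the vectors of one are obtained from those of the other by applying a common complex orthogonal transformation and multiplying the vectors by non-zero scalars. The configuration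 $\mathcal A_{(m,1^n)}$ is the configuration of type $(m,1^n)$ with $\alpha_0=(1,0)$ and $\alpha_j=(\cos\varphi_j,\sin\varphi_j)$, $\varphi_j\in\mathbb{C}$, for $1\le j\le n$, such that the elementary symmetric polynomials $e_i$ of $z_j=e^{2\sqrt{-1}\,\varphi_j}$, $1\le j\le n$, satisfy $$e_i=(-1)^i\binom{n}{i}\binom{m+i-1}{i}\binom{m+n-1}{i}^{-1},\qquad 1\le i\le n.$$ Theorem. If a configuration $\mathcal A$ of type $(m,1^n)$ is Gorenstein, then $\mathcal A$ is equivalent to $\mathcal A_{(m,1^n)}$. That is, up to equivalence there is no Gorenstein configuration of type $(m,1^n)$ other than $\mathcal A_{(m,1^n)}$. -/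

import Mathlib

open MvPolynomial Polynomial
open scoped Matrix

noncomputable section

/-- A configuration of `n + 1` vectors in `ℂ²` with positive integer multiplicities. The vectors
are pairwise non-collinear and non-isotropic for the standard complex bilinear form
`(x, y) = x₁ y₁ + x₂ y₂` (no complex conjugation). -/
structure Configuration (n : ℕ) where
  vec : Fin (n + 1) → Fin 2 → ℂ
  mult : Fin (n + 1) → ℕ
  mult_pos : ∀ i, 0 < mult i
  nonisotropic : ∀ i, vec i ⬝ᵥ vec i ≠ 0
  noncollinear : ∀ i j, i ≠ j → LinearIndependent ℂ ![vec i, vec j]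

/-- The derivative `∂_α = α₁ ∂/∂x₁ + α₂ ∂/∂x₂` of polynomials in two variables. -/
def dirDeriv (α : Fin 2 → ℂ) : Module.End ℂ (MvPolynomial (Fin 2) ℂ) :=
  ∑ i : Fin 2, α i • (pderiv i).toLinearMap

namespace Configuration

variable {n : ℕ}

/-- The configuration has type `(m, 1ⁿ)`: the multiplicities are `m, 1, …, 1`. -/
def HasType (A : Configuration n) (m : ℕ) : Prop :=
  A.mult 0 = m ∧ ∀ j : Fin n, A.mult j.succ = 1

/-- Equivalence of configurations: after a renumbering that respects multiplicities, the vectors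
agree up to a common complex orthogonal transformation and individual non-zero scalars. -/
def Equivalent (A B : Configuration n) : Prop :=
  ∃ (σ : Equiv.Perm (Fin (n + 1))) (O : Matrix (Fin 2) (Fin 2) ℂ) (c : Fin (n + 1) → ℂ),
    Oᵀ * O = 1 ∧
      ∀ i, c i ≠ 0 ∧ B.mult (σ i) = A.mult i ∧ B.vec (σ i) = c i • (O *ᵥ A.vec i)

/-- `p` is quasi-invariant: for every vector `α` of multiplicity `k` and every `1 ≤ s ≤ k`, the
polynomial `∂_α^(2s-1) p` vanishes on the line `(α, x) = 0`. -/
def IsQuasiInvariant (A : Configuration n) (p : MvPolynomial (Fin 2) ℂ) : Prop :=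
  ∀ i, ∀ s, 1 ≤ s → s ≤ A.mult i → ∀ x : Fin 2 → ℂ, A.vec i ⬝ᵥ x = 0 →
    MvPolynomial.eval x ((dirDeriv (A.vec i) ^ (2 * s - 1)) p) = 0

/-- The space of all quasi-invariants. -/
def quasiInvariants (A : Configuration n) : Submodule ℂ (MvPolynomial (Fin 2) ℂ) where
  carrier := {p | A.IsQuasiInvariant p}
  zero_mem' := fun i s _ _ x _ => by simp
  add_mem' := fun hp hq i s h1 h2 x hx => by
    rw [map_add, map_add, hp i s h1 h2 x hx, hq i s h1 h2 x hx, add_zero]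
  smul_mem' := fun c p hp i s h1 h2 x hx => by
    rw [map_smul, MvPolynomial.smul_eval, hp i s h1 h2 x hx, mul_zero]

/-- The Hilbert series: the coefficient of `t^k` is the dimension of the (finite-dimensional) space
of quasi-invariants that are homogeneous of degree `k`. -/
def hilbertSeries (A : Configuration n) : PowerSeries ℚ :=
  PowerSeries.mk fun k =>
    (Module.finrank ℂ ↥(A.quasiInvariants ⊓ homogeneousSubmodule (Fin 2) ℂ k) : ℚ)

/-- The Hilbert series is (the expansion at `t = 0` of) a rational function `P(t) = N(t) / D(t)`
such that `P(t⁻¹) = t^M P(t)` for some integer `M`. The identity of rational functions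
`N(t⁻¹) / D(t⁻¹) = t^M N(t) / D(t)` is written, with denominators cleared, in the ring of Laurent
polynomials, where `LaurentPolynomial.invert` is the substitution `t ↦ t⁻¹`. Its validity does not
depend on the choice of `N` and `D`. -/
def IsGorenstein (A : Configuration n) : Prop :=
  ∃ (N D : ℚ[X]) (M : ℤ), D ≠ 0 ∧ A.hilbertSeries * (D : PowerSeries ℚ) = (N : PowerSeries ℚ) ∧
    LaurentPolynomial.invert (Polynomial.toLaurent N) * Polynomial.toLaurent D =
      LaurentPolynomial.T M * Polynomial.toLaurent N *
        LaurentPolynomial.invert (Polynomial.toLaurent D)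

/-- `A` is the configuration `𝒜_(m, 1ⁿ)`: it has type `(m, 1ⁿ)`, the vector of multiplicity `m` is
`(1, 0)`, the others are `(cos φⱼ, sin φⱼ)` for complex `φⱼ`, and the elementary symmetric
polynomials of `zⱼ = exp (2 i φⱼ)`, `1 ≤ j ≤ n`, have the prescribed values. -/
def IsStandard (A : Configuration n) (m : ℕ) : Prop :=
  A.HasType m ∧ A.vec 0 = ![1, 0] ∧
    ∃ φ : Fin n → ℂ, (∀ j, A.vec j.succ = ![Complex.cos (φ j), Complex.sin (φ j)]) ∧
      ∀ i, 1 ≤ i → i ≤ n →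
        ((Finset.univ : Finset (Fin n)).val.map
            fun j => Complex.exp (2 * Complex.I * φ j)).esymm i =
          (-1 : ℂ) ^ i * (n.choose i : ℂ) * ((m + i - 1).choose i : ℂ) *
            ((m + n - 1).choose i : ℂ)⁻¹

end Configuration

end

/-! In the isotropic coordinates u = x₁ + i x₂, v = x₁ - i x₂, a form of degree k is a vector of
coefficients c_l, 0 ≤ l ≤ k, and quasi-invariance is a system of ν = m + n linear equations on it.
The equation of order r for α has coefficients w^l K_r(2l - k), where w is the value of u/v on the
line orthogonal to α and K_r is a Kravchuk polynomial of degree r. Let w_j belong to α_j and put z_j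
= w_j / w_0.

For large k the equations are independent, so b_k = k + 1 - ν. Since b_0 = 1, the symmetry of the
series then forces b_{2ν-2} = ν (`hilbertFunction_of_symmetric`), one more than independent
equations would leave. In degree 2ν - 2 the equations are therefore dependent. Each K_r with r odd
is divisible by its variable, so a dependency divided by w_0^l (2l - k) is a sequence E(l) + ∑ B_j
z_j^l with deg E ≤ 2m - 2 that vanishes on [0, 2ν - 2] except at the midpoint ν - 1
(`Configuration.exists_exponential_of_dependent`).

Let P = ∏ (X - z_j) and G = (X - 1)^(2m-1) P. Every shift of G annihilates such a sequence, and the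
value at the midpoint cannot be zero, so the coefficients of G at m, …, m + n - 1 vanish. A
hypergeometric operator then maps G to a multiple of (X - 1)^(2m-1) with at most 2m - 2 terms, which
must be 0 (`lt_card_support_of_X_sub_one_pow_dvd`). The resulting recurrence determines P, hence the
z_j up to order. Rotating α_0 to (1, 0) turns z_j into exp(2iφ_j). -/

/-! ### Number of terms of multiples of (X - 1)^k. -/

section SparsePolynomial

/-- A nonzero polynomial divisible by `(X - 1)^k` has more than `k` terms. -/
theorem lt_card_support_of_X_sub_one_pow_dvd (k : ℕ) :
    ∀ f : ℂ[X], f ≠ 0 → (Polynomial.X - 1 : ℂ[X]) ^ k ∣ f → k < f.support.card := by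
  induction k with
  | zero =>
    intro f hf _
    simpa [Finset.card_pos] using hf
  | succ k ih =>
    intro f hf hdvd
    -- Dividing by a power of `X` makes the constant term nonzero without adding terms.
    -- Differentiation then loses a term and costs only one factor `X - 1`.
    obtain ⟨q, hq, hq0⟩ : ∃ q : ℂ[X], f = q * Polynomial.X ^ f.natTrailingDegree ∧
        q.coeff 0 ≠ 0 := by
      obtain ⟨q, hq⟩ := (Polynomial.X_pow_dvd_iff (f := f) (n := f.natTrailingDegree)).2
        fun d hd => Polynomial.coeff_eq_zero_of_lt_natTrailingDegree hd
      refine ⟨q, by rw [mul_comm]; exact hq, ?_⟩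
      have h1 : f.coeff f.natTrailingDegree ≠ 0 := by
        simpa [Polynomial.trailingCoeff] using
          (mt Polynomial.trailingCoeff_eq_zero.1 hf)
      have h2 := Polynomial.coeff_X_pow_mul q f.natTrailingDegree 0
      rw [← hq, zero_add] at h2
      rwa [← h2]
    have hcard : q.support.card ≤ f.support.card := by
      rw [← Finset.card_image_of_injective q.support
        (add_left_injective f.natTrailingDegree)]
      refine Finset.card_le_card fun i hi => ?_
      obtain ⟨j, hj, rfl⟩ := Finset.mem_image.1 hi
      rw [Polynomial.mem_support_iff] at hj ⊢
      have := Polynomial.coeff_mul_X_pow q f.natTrailingDegree j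
      rw [← hq] at this
      rwa [this]
    have hcop : IsCoprime ((Polynomial.X - 1 : ℂ[X]) ^ (k + 1))
        (Polynomial.X ^ f.natTrailingDegree) := by
      have h1 : IsCoprime (Polynomial.X - 1 : ℂ[X]) Polynomial.X := ⟨-1, 1, by ring⟩
      exact h1.pow
    have hdq : (Polynomial.X - 1 : ℂ[X]) ^ (k + 1) ∣ q := 
      hcop.dvd_of_dvd_mul_right (hq ▸ hdvd)
    have hdq' : (Polynomial.X - 1 : ℂ[X]) ^ k ∣ derivative q :=
      by simpa using pow_sub_one_dvd_derivative_of_pow_dvd (n := k + 1) hdq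
    have hq' : derivative q ≠ 0 := by
      intro h
      have hc := Polynomial.derivative_eq_zero.1 h
      rw [Polynomial.eq_C_of_natDegree_eq_zero hc] at hdq
      obtain ⟨r, hr⟩ := hdq
      have := congrArg (Polynomial.eval 1) hr
      simp at this
      exact hq0 this
    have h2 := ih _ hq' hdq'
    have h3 : (derivative q).support.card < q.support.card := by
      have hsub : (derivative q).support.image (· + 1) ⊆ q.support.erase 0 := by
        intro i hi
        obtain ⟨j, hj, rfl⟩ := Finset.mem_image.1 hi
        rw [Polynomial.mem_support_iff, coeff_derivative] at hj
        simp only [Finset.mem_erase, Polynomial.mem_support_iff]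
        exact ⟨by omega, left_ne_zero_of_mul hj⟩
      have h4 := Finset.card_le_card hsub
      rw [Finset.card_image_of_injective _ (add_left_injective 1),
        Finset.card_erase_of_mem (by simpa using hq0)] at h4
      have : 0 < q.support.card := Finset.card_pos.2 ⟨0, by simpa using hq0⟩
      omega
    omega

end SparsePolynomial

/-! ### Hypergeometric operators and Euler's transformation. -/

section EulerOperator

/-- The Euler operator `X d/dX`. -/
noncomputable def eulerOp (f : ℂ[X]) : ℂ[X] := Polynomial.X * derivative f

theorem coeff_eulerOp (f : ℂ[X]) (k : ℕ) : (eulerOp f).coeff k = k * f.coeff k := by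
  cases k with
  | zero => simp [eulerOp]
  | succ k => rw [eulerOp, Polynomial.coeff_X_mul, coeff_derivative]; push_cast; ring

theorem X_sub_one_pow_dvd_eulerOp {f : ℂ[X]} {k : ℕ} (h : (Polynomial.X - 1 : ℂ[X]) ^ (k + 1) ∣ f) :
    (Polynomial.X - 1 : ℂ[X]) ^ k ∣ eulerOp f := by
  obtain ⟨r, rfl⟩ := h
  refine ⟨Polynomial.X * ((k + 1 : ℂ[X]) * r + (Polynomial.X - 1 : ℂ[X]) * derivative r), ?_⟩
  simp only [eulerOp, derivative_mul, derivative_pow_succ, derivative_sub, derivative_X,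
    derivative_one]
  simp
  ring

/-- The hypergeometric operator `θ (θ - c) - X (θ + a) (θ + b)`. -/
noncomputable def hypergeometricOp (a b c : ℂ) (f : ℂ[X]) : ℂ[X] :=
  eulerOp (eulerOp f) - Polynomial.C c * eulerOp f -
    Polynomial.X * (eulerOp (eulerOp f) + Polynomial.C (a + b) * eulerOp f +
      Polynomial.C (a * b) * f)

theorem coeff_zero_hypergeometricOp (a b c : ℂ) (f : ℂ[X]) :
    (hypergeometricOp a b c f).coeff 0 = 0 := by
  simp [hypergeometricOp, eulerOp, mul_coeff_zero]

theorem coeff_succ_hypergeometricOp (a b c : ℂ) (f : ℂ[X]) (k : ℕ) :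
    (hypergeometricOp a b c f).coeff (k + 1) =
      f.coeff (k + 1) * ((k + 1) * (k + 1 - c)) - f.coeff k * ((k + a) * (k + b)) := by
  simp only [hypergeometricOp, Polynomial.coeff_sub, Polynomial.coeff_add, Polynomial.coeff_X_mul,
    Polynomial.coeff_C_mul, coeff_eulerOp]
  push_cast; ring

/-- Euler's transformation of the hypergeometric equation. -/
theorem hypergeometricOp_X_sub_one_pow_mul (m n : ℕ) (hm : 1 ≤ m) (f : ℂ[X]) :
    hypergeometricOp (1 - m) (1 - 2 * m - n) (m + n) ((Polynomial.X - 1 : ℂ[X]) ^ (2 * m - 1) * f) =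
      (Polynomial.X - 1 : ℂ[X]) ^ (2 * m - 1) * hypergeometricOp m (-n) (m + n) f := by
  obtain ⟨k, rfl⟩ : ∃ k, m = k + 1 := ⟨m - 1, by omega⟩
  have hk : 2 * (k + 1) - 1 = 2 * k + 1 := by omega
  rw [hk]
  have hX : (Polynomial.X - 1 : ℂ[X]) ≠ 0 := by
    simpa using Polynomial.X_sub_C_ne_zero (1 : ℂ)
  -- The extra factor `X - 1` avoids the exponent a - 1; it is cancelled at the end.
  have h1 : ∀ (a : ℕ) (g : ℂ[X]), (Polynomial.X - 1 : ℂ[X]) * eulerOp ((Polynomial.X - 1 : ℂ[X]) ^ a * g) =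
      (Polynomial.X - 1 : ℂ[X]) ^ a * ((Polynomial.X - 1 : ℂ[X]) * eulerOp g + (a : ℂ[X]) * Polynomial.X * g) := by
    intro a g
    cases a with
    | zero => simp
    | succ a =>
      simp only [eulerOp, derivative_mul, derivative_pow_succ, derivative_sub, derivative_X,
        derivative_one]
      simp
      ring
  have h2 : eulerOp ((Polynomial.X - 1 : ℂ[X]) ^ (2 * k + 1) * f) = (Polynomial.X - 1 : ℂ[X]) ^ (2 * k) *
      ((Polynomial.X - 1 : ℂ[X]) * eulerOp f + ((2 * k + 1 : ℕ) : ℂ[X]) * Polynomial.X * f) := by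
    apply mul_left_cancel₀ hX
    rw [h1]; ring
  have h3 := h1 (2 * k) ((Polynomial.X - 1 : ℂ[X]) * eulerOp f + ((2 * k + 1 : ℕ) : ℂ[X]) * Polynomial.X * f)
  rw [← h2] at h3
  have h4 : eulerOp ((Polynomial.X - 1 : ℂ[X]) * eulerOp f + ((2 * k + 1 : ℕ) : ℂ[X]) * Polynomial.X * f) =
      Polynomial.X * eulerOp f + (Polynomial.X - 1 : ℂ[X]) * eulerOp (eulerOp f) +
        ((2 * k + 1 : ℕ) : ℂ[X]) * Polynomial.X * f + ((2 * k + 1 : ℕ) : ℂ[X]) * Polynomial.X * eulerOp f := by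
    simp only [eulerOp, derivative_mul, derivative_add, derivative_sub, derivative_X,
      derivative_one, derivative_natCast]
    ring
  rw [h4] at h3
  apply mul_left_cancel₀ hX
  simp only [hypergeometricOp]
  have h5 : ∀ a b u v w : ℂ[X], (Polynomial.X - 1 : ℂ[X]) * (u - a * v - Polynomial.X * (u + b * v + w)) =
      (1 - Polynomial.X) * ((Polynomial.X - 1 : ℂ[X]) * u) -
      (a + Polynomial.X * b) * ((Polynomial.X - 1 : ℂ[X]) * v) -
        Polynomial.X * (Polynomial.X - 1 : ℂ[X]) * w := by
    intros; ring
  rw [h5, h3, h2]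
  simp only [map_add, map_sub, map_mul, map_neg, map_natCast, map_one, map_ofNat]
  push_cast
  ring

end EulerOperator

/-! ### Rigidity of P from the gap in (X - 1)^(2m-1) P. -/

/-- If the middle coefficients of `(X - 1)^(2m-1) P` vanish, then `P` is hypergeometric. -/
theorem coeff_recurrence_of_middle_coeff_eq_zero (m n : ℕ) (hm : 1 ≤ m) (P : ℂ[X])
    (hP : P.natDegree ≤ n)
    (h : ∀ i, m ≤ i → i < m + n → ((Polynomial.X - 1 : ℂ[X]) ^ (2 * m - 1) * P).coeff i = 0) (k : ℕ) :
    P.coeff (k + 1) * ((k + 1) * (k + 1 - (m + n))) = P.coeff k * ((k + m) * (k - n)) := by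
  set G := (Polynomial.X - 1 : ℂ[X]) ^ (2 * m - 1) * P with hG
  have hdeg : G.natDegree ≤ 2 * m - 1 + n := by
    refine natDegree_mul_le.trans (add_le_add ?_ hP)
    have h1 : (Polynomial.X - 1 : ℂ[X]).natDegree = 1 := by
      simpa using natDegree_X_sub_C (1 : ℂ)
    refine natDegree_pow_le.trans ?_
    rw [h1, mul_one]
  have key : hypergeometricOp m (-n) (m + n) P = 0 := by
    by_contra hne
    have h2 := hypergeometricOp_X_sub_one_pow_mul m n hm P
    have hX : (Polynomial.X - 1 : ℂ[X]) ≠ 0 := by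
      simpa using Polynomial.X_sub_C_ne_zero (1 : ℂ)
    have h3 := lt_card_support_of_X_sub_one_pow_dvd (2 * m - 1) _
      (mul_ne_zero (pow_ne_zero _ hX) hne) (Dvd.intro _ rfl)
    rw [← h2, ← hG] at h3
    -- `G` lives on [0, m-1] and [m+n, 2m+n-1]. The factor θ(θ - c) kills the exponents 0 and m+n,
    -- and (θ + a)(θ + b) kills m-1 and 2m+n-1, so neither block is lengthened by the shift `X`.
    -- Only 2(m - 1) exponents survive, too few for a nonzero multiple of (X - 1)^(2m-1).
    have h4 : (hypergeometricOp (1 - m) (1 - 2 * m - n) (m + n) G).support ⊆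
        Finset.Ico 1 m ∪ Finset.Ico (m + n + 1) (2 * m + n) := by
      intro e he
      by_contra hnot
      simp only [Finset.mem_union, Finset.mem_Ico, not_or, not_and, not_lt] at hnot
      rw [Polynomial.mem_support_iff] at he
      apply he
      cases e with
      | zero => exact coeff_zero_hypergeometricOp _ _ _ _
      | succ j =>
        rw [coeff_succ_hypergeometricOp]
        have hA : G.coeff (j + 1) * ((j + 1) * (j + 1 - (m + n) : ℂ)) = 0 := by
          by_cases hj : j + 1 < m + n
          · rw [h _ (by omega) hj, zero_mul]
          · by_cases hj2 : j + 1 = m + n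
            · have : (j + 1 : ℂ) = m + n := by exact_mod_cast hj2
              rw [this]; ring
            · rw [coeff_eq_zero_of_natDegree_lt (by omega), zero_mul]
        have hB : G.coeff j * ((j + (1 - m)) * (j + (1 - 2 * m - n)) : ℂ) = 0 := by
          by_cases hj : j + 1 = m
          · have : (m : ℂ) = j + 1 := by exact_mod_cast hj.symm
            rw [this]; ring
          · by_cases hj1 : j < m + n
            · rw [h _ (by omega) hj1, zero_mul]
            · by_cases hj2 : j + 1 = 2 * m + n
              · have : (j : ℂ) = 2 * m + n - 1 := by
                  rw [eq_sub_iff_add_eq]; exact_mod_cast hj2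
                rw [this]; ring
              · rw [coeff_eq_zero_of_natDegree_lt (by omega), zero_mul]
        rw [hA, hB, sub_zero]
    have h5 := (Finset.card_le_card h4).trans (Finset.card_union_le _ _)
    simp only [Nat.card_Ico] at h5
    omega
  have h6 := coeff_succ_hypergeometricOp m (-n) (m + n) P k
  rw [key, Polynomial.coeff_zero] at h6
  rw [eq_comm, sub_eq_zero] at h6
  rw [h6]; ring

/-- For k < n the factor (k + m)(k - n) is nonzero, so the recurrence runs downwards from the
leading coefficient 1. -/
theorem coeff_of_middle_coeff_eq_zero (m n : ℕ) (hm : 1 ≤ m) (P : ℂ[X])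
    (hP : P.Monic) (hdeg : P.natDegree = n)
    (h : ∀ i, m ≤ i → i < m + n → ((Polynomial.X - 1 : ℂ[X]) ^ (2 * m - 1) * P).coeff i = 0)
    (i : ℕ) (hi : i ≤ n) :
    P.coeff (n - i) = (n.choose i : ℂ) * ((m + i - 1).choose i : ℂ) *
      ((m + n - 1).choose i : ℂ)⁻¹ := by
  obtain ⟨m, rfl⟩ : ∃ k, m = k + 1 := ⟨m - 1, by omega⟩
  induction i with
  | zero => simp [← hdeg, hP.coeff_natDegree]
  | succ i ih =>
    have ih := ih (by omega)
    have h1 := coeff_recurrence_of_middle_coeff_eq_zero (m + 1) n hm P hdeg.le h (n - (i + 1))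
    obtain ⟨d, rfl⟩ : ∃ d, n = i + 1 + d := ⟨n - (i + 1), by omega⟩
    have e1 : i + 1 + d - (i + 1) = d := by omega
    have e2 : i + 1 + d - i = d + 1 := by omega
    have e3 : m + 1 + (i + 1) - 1 = m + i + 1 := by omega
    have e4 : m + 1 + (i + 1 + d) - 1 = m + i + d + 1 := by omega
    have e5 : m + 1 + i - 1 = m + i := by omega
    rw [e1] at h1
    rw [e2, e4, e5] at ih
    rw [e1, e3, e4]
    rw [ih] at h1
    have c1 : ((i + 1 + d).choose (i + 1) : ℂ) * (i + 1) = (i + 1 + d).choose i * (d + 1) := by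
      have := Nat.choose_succ_right_eq (i + 1 + d) i
      rw [e2] at this
      exact_mod_cast this
    have c2 : ((m + i + 1).choose (i + 1) : ℂ) * (i + 1) = (m + i + 1) * (m + i).choose i := by
      have := Nat.add_one_mul_choose_eq (m + i) i
      exact_mod_cast this.symm
    have c3 : ((m + i + d + 1).choose (i + 1) : ℂ) * (i + 1) =
        (m + i + d + 1).choose i * (m + d + 1) := by
      have := Nat.choose_succ_right_eq (m + i + d + 1) i
      rw [show m + i + d + 1 - i = m + d + 1 by omega] at this
      exact_mod_cast this
    have n1 : ((m + i + d + 1).choose i : ℂ) ≠ 0 := by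
      exact_mod_cast (Nat.choose_pos (by omega)).ne'
    have n2 : ((m + i + d + 1).choose (i + 1) : ℂ) ≠ 0 := by
      exact_mod_cast (Nat.choose_pos (by omega)).ne'
    have n3 : (i + 1 : ℂ) ≠ 0 := by exact_mod_cast Nat.succ_ne_zero i
    have n4 : (m + d + 1 : ℂ) ≠ 0 := by exact_mod_cast Nat.succ_ne_zero (m + d)
    set u := ((i + 1 + d).choose (i + 1) : ℂ)
    set u' := ((i + 1 + d).choose i : ℂ)
    set v := ((m + i + 1).choose (i + 1) : ℂ)
    set v' := ((m + i).choose i : ℂ)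
    set t := ((m + i + d + 1).choose (i + 1) : ℂ)
    set t' := ((m + i + d + 1).choose i : ℂ)
    push_cast at h1
    have h2 : u' * v' * (d + 1) * (m + i + 1) = P.coeff d * (m + d + 1) * (i + 1) * t' := by
      field_simp at h1
      linear_combination -h1
    rw [eq_mul_inv_iff_mul_eq₀ n2]
    apply mul_right_cancel₀ (mul_ne_zero n3 n3)
    calc P.coeff d * t * ((i + 1) * (i + 1)) = P.coeff d * (i + 1) * (t * (i + 1)) := by ring
      _ = u' * v' * (d + 1) * (m + i + 1) := by rw [c3, h2]; ring
      _ = (u' * (d + 1)) * ((m + i + 1) * v') := by ring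
      _ = u * v * ((i + 1) * (i + 1)) := by rw [← c1, ← c2]; ring

/-! ### Annihilators of exponential polynomials. -/

section ExponentialSums

theorem coeff_iterate_eulerOp (f : ℂ[X]) (k l : ℕ) :
    (eulerOp^[k] f).coeff l = (l : ℂ) ^ k * f.coeff l := by
  induction k with
  | zero => simp
  | succ k ih => rw [Function.iterate_succ_apply', coeff_eulerOp, ih]; ring

theorem X_sub_one_pow_dvd_iterate_eulerOp (f : ℂ[X]) (k d : ℕ)
    (h : (Polynomial.X - 1 : ℂ[X]) ^ (d + k) ∣ f) :
    (Polynomial.X - 1 : ℂ[X]) ^ d ∣ eulerOp^[k] f := by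
  induction k generalizing d with
  | zero => simpa using h
  | succ k ih =>
    rw [Function.iterate_succ_apply']
    exact X_sub_one_pow_dvd_eulerOp (ih (d + 1) (by rwa [add_right_comm, add_assoc]))

/-- A polynomial in the index pairs to zero with the coefficients of a multiple of a high power of
`X - 1`. -/
theorem sum_coeff_mul_eval_eq_zero {D M : ℕ} (E g : ℂ[X]) (hE : E.natDegree < D)
    (hg : (Polynomial.X - 1 : ℂ[X]) ^ D ∣ g) (hM : g.natDegree < M) :
    ∑ l ∈ Finset.range M, g.coeff l * E.eval (l : ℂ) = 0 := by
  simp_rw [Polynomial.eval_eq_sum_range' hE, Finset.mul_sum]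
  rw [Finset.sum_comm]
  refine Finset.sum_eq_zero fun k hk => ?_
  -- The sum of g_l l^k is the value at 1 of θ^k g, where θ = X d/dX, and k < D leaves a factor `X -
  -- 1`.
  have h1 : (Polynomial.X - 1 : ℂ[X]) ^ 1 ∣ eulerOp^[k] g :=
    X_sub_one_pow_dvd_iterate_eulerOp g k 1
      ((pow_dvd_pow _ (by have := Finset.mem_range.1 hk; omega)).trans hg)
  have h2 : (eulerOp^[k] g).eval 1 = 0 := by
    obtain ⟨r, hr⟩ := h1
    rw [hr]; simp
  have h3 : (eulerOp^[k] g).natDegree < M := by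
    refine lt_of_le_of_lt ?_ hM
    refine Polynomial.natDegree_le_iff_coeff_eq_zero.2 fun N hN => ?_
    rw [coeff_iterate_eulerOp, coeff_eq_zero_of_natDegree_lt hN, mul_zero]
  rw [Polynomial.eval_eq_sum_range' h3] at h2
  simp only [coeff_iterate_eulerOp, one_pow, mul_one] at h2
  rw [← mul_zero (E.coeff k), ← h2, Finset.mul_sum]
  exact Finset.sum_congr rfl fun l _ => by ring

/-- The pairing of the coefficients of `g` with an exponential polynomial. -/
theorem sum_coeff_mul_exponential {D M n : ℕ} (E g : ℂ[X]) (B z : Fin n → ℂ)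
    (hE : E.natDegree < D) (hg : (Polynomial.X - 1 : ℂ[X]) ^ D ∣ g) (hM : g.natDegree < M) :
    ∑ l ∈ Finset.range M, g.coeff l * (E.eval (l : ℂ) + ∑ j, B j * z j ^ l) =
      ∑ j, B j * g.eval (z j) := by
  simp_rw [mul_add, Finset.sum_add_distrib]
  rw [sum_coeff_mul_eval_eq_zero E g hE hg hM, zero_add]
  simp_rw [Finset.mul_sum]
  rw [Finset.sum_comm]
  refine Finset.sum_congr rfl fun j _ => ?_
  rw [Polynomial.eval_eq_sum_range' hM, Finset.mul_sum]
  exact Finset.sum_congr rfl fun l _ => by ring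

theorem natDegree_X_sub_one_pow (D : ℕ) : ((Polynomial.X - 1 : ℂ[X]) ^ D).natDegree = D := by
  have h := natDegree_X_sub_C (1 : ℂ)
  rw [map_one] at h
  rw [natDegree_pow, h, mul_one]

/-- Pairing with X^l₀ (X - 1)^D ∏_{k ≠ j} (X - z k) kills E and every frequency except z j, leaving
B j times a nonzero value. -/
theorem exponential_coeff_eq_zero {D M n : ℕ} (l₀ : ℕ) (E : ℂ[X]) (B z : Fin n → ℂ)
    (hE : E.natDegree < D) (hz : Function.Injective z) (hz0 : ∀ j, z j ≠ 0) (hz1 : ∀ j, z j ≠ 1)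
    (hM : D + n ≤ M)
    (h : ∀ l, l₀ ≤ l → l < l₀ + M → E.eval (l : ℂ) + ∑ j, B j * z j ^ l = 0) (j : Fin n) :
    B j = 0 := by
  set Q : ℂ[X] := ∏ k ∈ Finset.univ.erase j, (Polynomial.X - Polynomial.C (z k)) with hQ
  set g : ℂ[X] := Polynomial.X ^ l₀ * ((Polynomial.X - 1) ^ D * Q) with hgdef
  have hQdeg : Q.natDegree = n - 1 := by
    rw [hQ, natDegree_prod_of_monic _ _ fun k _ => monic_X_sub_C _]
    simp
  have hn : 0 < n := j.pos
  have hgdeg : g.natDegree < l₀ + M := by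
    refine lt_of_le_of_lt natDegree_mul_le ?_
    have h1 : ((Polynomial.X - 1 : ℂ[X]) ^ D * Q).natDegree ≤ D + (n - 1) :=
      natDegree_mul_le.trans (by rw [natDegree_X_sub_one_pow, hQdeg])
    rw [natDegree_X_pow]
    omega
  have h1 := sum_coeff_mul_exponential E g B z hE
    (Dvd.intro_left (Polynomial.X ^ l₀ * Q) (by rw [hgdef]; ring)) hgdeg
  rw [Finset.sum_eq_zero, Finset.sum_eq_single j] at h1
  · have h2 : g.eval (z j) ≠ 0 := by
      simp only [hgdef, hQ, Polynomial.eval_mul, Polynomial.eval_pow, Polynomial.eval_X,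
        Polynomial.eval_sub, Polynomial.eval_one, Polynomial.eval_prod, Polynomial.eval_C]
      refine mul_ne_zero (pow_ne_zero _ (hz0 j)) (mul_ne_zero
        (pow_ne_zero _ (sub_ne_zero.2 (hz1 j))) (Finset.prod_ne_zero_iff.2 fun k hk => ?_))
      exact sub_ne_zero.2 (hz.ne (Finset.ne_of_mem_erase hk).symm)
    exact (mul_eq_zero.1 h1.symm).resolve_right h2
  · intro k _ hk
    have : Q.eval (z k) = 0 := by
      rw [hQ, Polynomial.eval_prod]
      exact Finset.prod_eq_zero (Finset.mem_erase.2 ⟨hk, Finset.mem_univ _⟩) (by simp)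
    simp [hgdef, this]
  · simp
  · intro l hl
    by_cases hl0 : l₀ ≤ l
    · rw [h l hl0 (Finset.mem_range.1 hl), mul_zero]
    · rw [hgdef, Polynomial.coeff_X_pow_mul', if_neg hl0, zero_mul]

theorem exponential_poly_eq_zero {D M n : ℕ} (l₀ : ℕ) (E : ℂ[X]) (B z : Fin n → ℂ)
    (hE : E.natDegree < D) (hz : Function.Injective z) (hz0 : ∀ j, z j ≠ 0) (hz1 : ∀ j, z j ≠ 1)
    (hM : D + n ≤ M)
    (h : ∀ l, l₀ ≤ l → l < l₀ + M → E.eval (l : ℂ) + ∑ j, B j * z j ^ l = 0) :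
    E = 0 := by
  have hB := exponential_coeff_eq_zero l₀ E B z hE hz hz0 hz1 hM h
  refine Polynomial.eq_zero_of_natDegree_lt_card_of_eval_eq_zero' E
    ((Finset.Ico l₀ (l₀ + M)).image ((↑) : ℕ → ℂ)) ?_ ?_
  · intro x hx
    obtain ⟨l, hl, rfl⟩ := Finset.mem_image.1 hx
    rw [Finset.mem_Ico] at hl
    simpa [hB] using h l hl.1 hl.2
  · rw [Finset.card_image_of_injective _ Nat.cast_injective, Nat.card_Ico]
    omega

/-- If an exponential polynomial vanishes on `[0, 2(m+n-1)]` except at the midpoint, then the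
frequencies are the roots of a hypergeometric polynomial. -/
theorem coeff_prod_of_exponential_eq_zero (m n : ℕ) (hm : 1 ≤ m) (E : ℂ[X]) (B z : Fin n → ℂ)
    (hE : E.natDegree < 2 * m - 1) (hz : Function.Injective z) (hz0 : ∀ j, z j ≠ 0)
    (hz1 : ∀ j, z j ≠ 1) (hne : E ≠ 0 ∨ ∃ j, B j ≠ 0)
    (h : ∀ l < 2 * (m + n) - 1, l ≠ m + n - 1 → E.eval (l : ℂ) + ∑ j, B j * z j ^ l = 0)
    (i : ℕ) (hi : i ≤ n) :
    (∏ j, (Polynomial.X - Polynomial.C (z j))).coeff (n - i) =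
      (n.choose i : ℂ) * ((m + i - 1).choose i : ℂ) * ((m + n - 1).choose i : ℂ)⁻¹ := by
  set P : ℂ[X] := ∏ j, (Polynomial.X - Polynomial.C (z j)) with hP
  have hmonic : P.Monic := monic_prod_of_monic _ _ fun j _ => monic_X_sub_C _
  have hdeg : P.natDegree = n := by
    rw [hP, natDegree_prod_of_monic _ _ fun k _ => monic_X_sub_C _]
    simp
  refine coeff_of_middle_coeff_eq_zero m n hm P hmonic hdeg (fun k hk1 hk2 => ?_) i hi
  set C := E.eval ((m + n - 1 : ℕ) : ℂ) + ∑ j, B j * z j ^ (m + n - 1) with hC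
  -- Otherwise the sequence vanishes on a full interval of length 2(m+n) - 1 ≥ (2m - 1) + n, which
  -- forces E = 0 and B = 0.
  have hC0 : C ≠ 0 := by
    intro hC0
    have h' : ∀ l, 0 ≤ l → l < 0 + (2 * (m + n) - 1) →
        E.eval (l : ℂ) + ∑ j, B j * z j ^ l = 0 := by
      intro l _ hl
      by_cases hl' : l = m + n - 1
      · rw [hl', ← hC, hC0]
      · exact h l (by omega) hl'
    rcases hne with hne | ⟨j, hj⟩
    · exact hne (exponential_poly_eq_zero 0 E B z hE hz hz0 hz1 (by omega) h')
    · exact hj (exponential_coeff_eq_zero 0 E B z hE hz hz0 hz1 (by omega) h' j)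
  set G : ℂ[X] := (Polynomial.X - 1) ^ (2 * m - 1) * P with hG
  -- This shift puts the k-th coefficient of `G` at the midpoint; k ≥ m keeps the shifted polynomial
  -- inside the interval.
  set e := m + n - 1 - k with he
  have hgdeg : (Polynomial.X ^ e * G).natDegree < 2 * (m + n) - 1 := by
    refine lt_of_le_of_lt natDegree_mul_le ?_
    have h1 : G.natDegree ≤ 2 * m - 1 + n :=
      natDegree_mul_le.trans (by rw [natDegree_X_sub_one_pow, hdeg])
    rw [natDegree_X_pow]
    omega
  have h1 := sum_coeff_mul_exponential E (Polynomial.X ^ e * G) B z hE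
    (Dvd.intro_left (Polynomial.X ^ e * P) (by rw [hG]; ring)) hgdeg
  rw [Finset.sum_eq_single (m + n - 1), ← hC, Finset.sum_eq_zero (s := Finset.univ),
    Polynomial.coeff_X_pow_mul', if_pos (by omega)] at h1
  · have h2 := (mul_eq_zero.1 h1).resolve_right hC0
    rwa [show m + n - 1 - e = k by omega] at h2
  · intro j _
    have : P.eval (z j) = 0 := by
      rw [hP, Polynomial.eval_prod]
      exact Finset.prod_eq_zero (Finset.mem_univ j) (by simp)
    simp [hG, this]
  · intro l hl hl'
    rw [h l (Finset.mem_range.1 hl) hl', mul_zero]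
  · intro h3
    exact absurd (Finset.mem_range.2 (by omega)) h3

end ExponentialSums

/-! ### Symmetry of the Hilbert series. -/

section HilbertSeries

/-- A polynomial with nonzero constant term that `t ↦ t⁻¹` shifts is palindromic. -/
theorem reverse_eq_of_invert_eq_shift (S : ℚ[X]) (e : ℤ) (h0 : S.coeff 0 ≠ 0)
    (h : LaurentPolynomial.invert (Polynomial.toLaurent S) =
      LaurentPolynomial.T e * Polynomial.toLaurent S) :
    S.reverse = S := by
  have h1 := LaurentPolynomial.toLaurent_reverse S
  rw [h, mul_right_comm, ← LaurentPolynomial.T_add] at h1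
  have hr : S.reverse.coeff 0 ≠ 0 := by
    rw [coeff_zero_reverse]
    exact leadingCoeff_ne_zero.2 fun h => h0 (by simp [h])
  -- `S` and its reverse both have nonzero constant term, so the power of t relating them is
  -- trivial.
  rcases le_total 0 (e + S.natDegree) with he | he
  · obtain ⟨f, hf⟩ := Int.eq_ofNat_of_zero_le he
    rw [hf, ← Polynomial.toLaurent_X_pow, ← map_mul] at h1
    have h2 := Polynomial.toLaurent_injective h1
    rcases Nat.eq_zero_or_pos f with rfl | hpos
    · rwa [pow_zero, one_mul] at h2
    · exfalso
      apply hr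
      rw [h2, Polynomial.coeff_X_pow_mul', if_neg (by omega)]
  · obtain ⟨f, hf⟩ := Int.eq_ofNat_of_zero_le (neg_nonneg.2 he)
    have h3 : Polynomial.toLaurent (Polynomial.X ^ f * S.reverse) = Polynomial.toLaurent S := by
      rw [map_mul, h1, Polynomial.toLaurent_X_pow, ← mul_assoc, ← LaurentPolynomial.T_add, ← hf,
        neg_add_cancel, LaurentPolynomial.T_zero, one_mul]
    have h2 := Polynomial.toLaurent_injective h3
    rcases Nat.eq_zero_or_pos f with rfl | hpos
    · rwa [pow_zero, one_mul] at h2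
    · exfalso
      apply h0
      rw [← h2, Polynomial.coeff_X_pow_mul', if_neg (by omega)]

theorem coeff_natDegree_sub_of_reverse_eq (S : ℚ[X]) (h : S.reverse = S) (i : ℕ)
    (hi : i ≤ S.natDegree) : S.coeff (S.natDegree - i) = S.coeff i := by
  conv_rhs => rw [← h]
  rw [coeff_reverse, revAt_le hi]

/-- Average the sum for S'(1) with its reflection i ↦ deg S - i. -/
theorem two_mul_eval_derivative_of_reverse_eq (S : ℚ[X]) (h : S.reverse = S) :
    2 * (derivative S).eval 1 = S.natDegree * S.eval 1 := by
  have h1 : (derivative S).eval 1 = ∑ i ∈ Finset.range (S.natDegree + 1), S.coeff i * i := by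
    rw [Polynomial.derivative_eval, Polynomial.sum_over_range _ (by simp)]
    simp
  have h2 : (derivative S).eval 1 =
      ∑ i ∈ Finset.range (S.natDegree + 1), S.coeff i * (S.natDegree - i) := by
    rw [h1, ← Finset.sum_range_reflect]
    refine Finset.sum_congr rfl fun i hi => ?_
    have hi' : i ≤ S.natDegree := Nat.lt_succ_iff.1 (Finset.mem_range.1 hi)
    rw [Nat.add_sub_cancel, coeff_natDegree_sub_of_reverse_eq S h i hi', Nat.cast_sub hi']
  rw [two_mul]
  nth_rewrite 1 [h1]
  rw [h2, ← Finset.sum_add_distrib, Polynomial.eval_eq_sum_range, Finset.mul_sum]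
  exact Finset.sum_congr rfl fun i _ => by simp; ring

/-- The sequence k + 1 - c has generating function (1 - c(1 - t)) / (1 - t)², and b differs from it
in finitely many places. -/
theorem mk_mul_one_sub_X_sq (b : ℕ → ℚ) (c : ℚ) (L : ℕ) (hb : ∀ k, L ≤ k → b k = k + 1 - c) :
    PowerSeries.mk b * (1 - PowerSeries.X) ^ 2 =
      ((1 - Polynomial.C c * (1 - Polynomial.X) + (1 - Polynomial.X) ^ 2 *
        ∑ k ∈ Finset.range L, Polynomial.monomial k (b k - (k + 1 - c)) : ℚ[X]) :
          PowerSeries ℚ) := by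
  have h1 : (PowerSeries.mk fun k : ℕ => (k + 1 : ℚ)) * (1 - PowerSeries.X) =
      PowerSeries.mk 1 := by
    ext k
    rw [mul_sub, mul_one, map_sub]
    cases k with
    | zero => simp
    | succ k => rw [PowerSeries.coeff_succ_mul_X]; simp
  have h2 : PowerSeries.mk b = (PowerSeries.mk fun k : ℕ => (k + 1 : ℚ)) -
      PowerSeries.C c * PowerSeries.mk 1 +
      ((∑ k ∈ Finset.range L, Polynomial.monomial k (b k - (k + 1 - c)) : ℚ[X]) :
        PowerSeries ℚ) := by
    ext k
    rw [map_add, map_sub]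
    simp only [PowerSeries.coeff_mk, PowerSeries.coeff_C_mul, Polynomial.coeff_coe,
      Polynomial.finsetSum_coeff, Polynomial.coeff_monomial,
      Finset.sum_ite_eq', Finset.mem_range, Pi.one_apply]
    split_ifs with hk
    · ring
    · rw [hb k (not_lt.1 hk)]; ring
  have h3 : (PowerSeries.mk 1 : PowerSeries ℚ) * (1 - PowerSeries.X) = 1 :=
    PowerSeries.mk_one_mul_one_sub_eq_one ℚ
  rw [h2]
  set R : ℚ[X] := ∑ k ∈ Finset.range L, Polynomial.monomial k (b k - (k + 1 - c))
  simp only [Polynomial.coe_add, Polynomial.coe_sub, Polynomial.coe_mul, Polynomial.coe_pow,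
    Polynomial.coe_one, Polynomial.coe_C, Polynomial.coe_X]
  linear_combination (1 - PowerSeries.X) * h1 + h3 - PowerSeries.C c * (1 - PowerSeries.X) * h3

/-- The symmetry of a Hilbert function that equals `k + 1 - ν` in large degrees. -/
theorem hilbertFunction_of_symmetric (b : ℕ → ℚ) (ν : ℕ) (hν : 1 ≤ ν) (L : ℕ)
    (hb : ∀ k, L ≤ k → b k = k + 1 - ν) (h0 : b 0 ≠ 0) (N D : ℚ[X]) (M : ℤ) (hD : D ≠ 0)
    (hP : PowerSeries.mk b * (D : PowerSeries ℚ) = (N : PowerSeries ℚ))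
    (hsymm : LaurentPolynomial.invert (Polynomial.toLaurent N) * Polynomial.toLaurent D =
      LaurentPolynomial.T M * Polynomial.toLaurent N *
        LaurentPolynomial.invert (Polynomial.toLaurent D)) :
    b (2 * ν - 2) = ν - 1 + b 0 := by
  set R : ℚ[X] := ∑ k ∈ Finset.range L, Polynomial.monomial k (b k - (k + 1 - ν)) with hR
  set S : ℚ[X] := 1 - Polynomial.C (ν : ℚ) * (1 - Polynomial.X) + (1 - Polynomial.X) ^ 2 * R
    with hS
  have hSb := mk_mul_one_sub_X_sq b ν L hb
  rw [← hR, ← hS] at hSb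
  have hRcoeff : ∀ k, R.coeff k = b k - (k + 1 - ν) := by
    intro k
    simp only [hR, Polynomial.finsetSum_coeff, Polynomial.coeff_monomial,
      Finset.sum_ite_eq', Finset.mem_range]
    split_ifs with hk
    · rfl
    · rw [hb k (not_lt.1 hk)]; ring
  have hS0 : S.coeff 0 = b 0 := by
    have := hRcoeff 0
    rw [Polynomial.coeff_zero_eq_eval_zero] at this ⊢
    rw [hS]
    simp [this]
  have hSD : S * D = (1 - Polynomial.X) ^ 2 * N := by
    apply Polynomial.coe_injective ℚ
    simp only [Polynomial.coe_sub, Polynomial.coe_mul, Polynomial.coe_pow,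
      Polynomial.coe_one, Polynomial.coe_X]
    rw [← hSb, ← hP]; ring
  -- The shift by -2 comes from (1 - t⁻¹)² = t⁻² (1 - t)².
  have hinv : LaurentPolynomial.invert (Polynomial.toLaurent S) =
      LaurentPolynomial.T (M - 2) * Polynomial.toLaurent S := by
    have h1 := congrArg Polynomial.toLaurent hSD
    have h2 := congrArg LaurentPolynomial.invert h1
    simp only [map_mul, map_pow, map_sub, map_one, Polynomial.toLaurent_X,
      LaurentPolynomial.invert_T] at h1 h2
    have hd : Polynomial.toLaurent D ≠ 0 := Polynomial.toLaurent_ne_zero.2 hD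
    have hd' : LaurentPolynomial.invert (Polynomial.toLaurent D) ≠ 0 := by simpa using hd
    apply mul_right_cancel₀ (mul_ne_zero hd' hd)
    have h3 : (1 - LaurentPolynomial.T (-1) : LaurentPolynomial ℚ) ^ 2 *
        LaurentPolynomial.T M =
        LaurentPolynomial.T (M - 2) * (1 - LaurentPolynomial.T 1) ^ 2 := by
      rw [show M - 2 = M + (-1 + -1) by ring, LaurentPolynomial.T_add, LaurentPolynomial.T_add]
      have h4 : (LaurentPolynomial.T (-1) : LaurentPolynomial ℚ) * LaurentPolynomial.T 1 = 1 := by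
        rw [← LaurentPolynomial.T_add]; simp
      linear_combination (-(LaurentPolynomial.T (-1) * LaurentPolynomial.T 1 + 1) *
        LaurentPolynomial.T M + 2 * LaurentPolynomial.T M * LaurentPolynomial.T (-1)) * h4
    calc _ = (LaurentPolynomial.invert (Polynomial.toLaurent S) *
          LaurentPolynomial.invert (Polynomial.toLaurent D)) * Polynomial.toLaurent D := by ring
      _ = (1 - LaurentPolynomial.T (-1)) ^ 2 *
          (LaurentPolynomial.invert (Polynomial.toLaurent N) * Polynomial.toLaurent D) := by
        rw [h2]; ring
      _ = ((1 - LaurentPolynomial.T (-1)) ^ 2 * LaurentPolynomial.T M) * Polynomial.toLaurent N *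
          LaurentPolynomial.invert (Polynomial.toLaurent D) := by rw [hsymm]; ring
      _ = LaurentPolynomial.T (M - 2) * ((1 - LaurentPolynomial.T 1) ^ 2 *
          Polynomial.toLaurent N) * LaurentPolynomial.invert (Polynomial.toLaurent D) := by
        rw [h3]; ring
      _ = _ := by rw [← h1]; ring
  have hrev := reverse_eq_of_invert_eq_shift S (M - 2) (by rwa [hS0]) hinv
  -- The form of `S` gives S(1) = 1 and S'(1) = ν, so palindromicity fixes the degree.
  have hdeg : S.natDegree = 2 * ν := by
    have h1 := two_mul_eval_derivative_of_reverse_eq S hrev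
    have h2 : S.eval 1 = 1 := by simp [hS]
    have h3 : (derivative S).eval 1 = ν := by
      simp [hS, Polynomial.derivative_pow]
    rw [h2, h3, mul_one] at h1
    exact_mod_cast h1.symm
  have htop : S.coeff (2 * ν) = b 0 := by
    have h1 := coeff_natDegree_sub_of_reverse_eq S hrev 0 (Nat.zero_le _)
    rwa [Nat.sub_zero, hdeg, hS0] at h1
  -- `(X - 1)^2 * R` agrees with `S` from degree 2 on, so the coefficient of `R` at 2ν - 2 is the
  -- top coefficient b 0 of `S`.
  have hq : (Polynomial.X - 1 : ℚ[X]) ^ 2 * R =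
      S - 1 + Polynomial.C (ν : ℚ) * (1 - Polynomial.X) := by
    rw [hS]; ring
  have hmon : ((Polynomial.X - 1 : ℚ[X]) ^ 2).Monic := by
    simpa using (monic_X_sub_C (1 : ℚ)).pow 2
  have hdeg2 : ((Polynomial.X - 1 : ℚ[X]) ^ 2).natDegree = 2 := by
    simpa using natDegree_X_sub_C (1 : ℚ)
  have hlow : ∀ k, 2 ≤ k →
      (S - 1 + Polynomial.C (ν : ℚ) * (1 - Polynomial.X)).coeff k = S.coeff k := by
    intro k hk
    simp [Polynomial.coeff_one, Polynomial.coeff_X, show k ≠ 0 by omega, show 1 ≠ k by omega]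
  have hRdeg : R.natDegree ≤ 2 * ν - 2 := by
    have h1 : (S - 1 + Polynomial.C (ν : ℚ) * (1 - Polynomial.X)).natDegree ≤ 2 * ν := by
      refine Polynomial.natDegree_le_iff_coeff_eq_zero.2 fun k hk => ?_
      rw [hlow k (by omega), coeff_eq_zero_of_natDegree_lt (by omega)]
    rw [← hq, hmon.natDegree_mul', hdeg2] at h1
    · omega
    · intro h
      rw [h, mul_zero] at hq
      have h2 := hlow (2 * ν) (by omega)
      rw [← hq, htop, Polynomial.coeff_zero] at h2
      exact h0 h2.symm
  have h5 : R.coeff (2 * ν - 2) = b 0 := by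
    have h1 := coeff_mul_add_eq_of_natDegree_le hdeg2.le hRdeg
    rw [show 2 + (2 * ν - 2) = 2 * ν by omega, hq, hlow _ (by omega), htop] at h1
    have h2 := hmon.coeff_natDegree
    rw [hdeg2] at h2
    rw [h1, h2, one_mul]
  rw [hRcoeff] at h5
  have h6 : ((2 * ν - 2 : ℕ) : ℚ) = 2 * ν - 2 := by
    rw [Nat.cast_sub (by omega)]; push_cast; ring
  rw [h6] at h5
  linarith

end HilbertSeries

/-! ### Kravchuk polynomials. -/

section Kravchuk

/-- The Kravchuk polynomials, in the variable `l - j` where `k = l + j`. -/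
noncomputable def kravchuk (k : ℂ) : ℕ → ℂ[X]
  | 0 => 1
  | 1 => Polynomial.X
  | r + 2 => Polynomial.C ((r + 2 : ℂ)⁻¹) *
      (Polynomial.X * kravchuk k (r + 1) - Polynomial.C (k - r) * kravchuk k r)

theorem coeff_one_add_X_pow_mul_one_sub_X_pow (l j r : ℕ) :
    ((1 + Polynomial.X : ℂ[X]) ^ l * (1 - Polynomial.X) ^ j).coeff r =
      (kravchuk (l + j : ℂ) r).eval (l - j : ℂ) := by
  set f : ℂ[X] := (1 + Polynomial.X) ^ l * (1 - Polynomial.X) ^ j with hf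
  -- This is (1 - X²) f' = ((l - j) - (l + j) X) f; its coefficients give the three-term recurrence.
  have ode : derivative f - Polynomial.X * (Polynomial.X * derivative f) =
      Polynomial.C (l - j : ℂ) * f - Polynomial.C (l + j : ℂ) * (Polynomial.X * f) := by
    have h1 : ∀ l : ℕ, (1 + Polynomial.X) * derivative ((1 + Polynomial.X : ℂ[X]) ^ l) =
        Polynomial.C (l : ℂ) * (1 + Polynomial.X) ^ l := by
      intro l
      cases l with
      | zero => simp
      | succ l => rw [Polynomial.derivative_pow_succ]; simp; ring
    have h2 : ∀ l : ℕ, (1 - Polynomial.X) * derivative ((1 - Polynomial.X : ℂ[X]) ^ l) =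
        -Polynomial.C (l : ℂ) * (1 - Polynomial.X) ^ l := by
      intro l
      cases l with
      | zero => simp
      | succ l => rw [Polynomial.derivative_pow_succ]; simp; ring
    rw [hf, derivative_mul]
    simp only [map_sub, map_add]
    linear_combination (1 - Polynomial.X) * (1 - Polynomial.X) ^ j * h1 l +
      (1 + Polynomial.X) * (1 + Polynomial.X) ^ l * h2 j
  have h0 : f.coeff 0 = 1 := by
    rw [Polynomial.coeff_zero_eq_eval_zero, hf]; simp
  have h1 : f.coeff 1 = l - j := by
    have h2 := congrArg (fun g => Polynomial.coeff g 0) ode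
    simp only [Polynomial.coeff_sub, Polynomial.coeff_X_mul_zero, Polynomial.coeff_C_mul,
      coeff_derivative, h0] at h2
    simpa using h2
  have hrec : ∀ r : ℕ, f.coeff (r + 2) * (r + 2) =
      (l - j) * f.coeff (r + 1) - (l + j - r) * f.coeff r := by
    intro r
    have h2 := congrArg (fun g => Polynomial.coeff g (r + 1)) ode
    simp only [Polynomial.coeff_sub, Polynomial.coeff_X_mul, Polynomial.coeff_C_mul,
      coeff_derivative] at h2
    have h3 : (Polynomial.X * derivative f).coeff r = r * f.coeff r := by
      simpa [eulerOp] using coeff_eulerOp f r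
    rw [h3] at h2
    push_cast at h2
    linear_combination h2
  have key : ∀ r : ℕ, f.coeff r = (kravchuk (l + j : ℂ) r).eval (l - j : ℂ) ∧
      f.coeff (r + 1) = (kravchuk (l + j : ℂ) (r + 1)).eval (l - j : ℂ) := by
    intro r
    induction r with
    | zero => simp [kravchuk, h0, h1]
    | succ r ih =>
      refine ⟨ih.2, ?_⟩
      have hr : (r + 2 : ℂ) ≠ 0 := by exact_mod_cast Nat.succ_ne_zero (r + 1)
      have h2 := hrec r
      rw [ih.1, ih.2] at h2
      simp only [kravchuk, Polynomial.eval_mul, Polynomial.eval_C, Polynomial.eval_sub,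
        Polynomial.eval_X]
      rw [eq_inv_mul_iff_mul_eq₀ hr, mul_comm]
      exact h2
  exact (key r).1

theorem kravchuk_degree_aux (k : ℂ) (r : ℕ) :
    ((kravchuk k r).natDegree ≤ r ∧ (kravchuk k r).coeff r ≠ 0) ∧
      ((kravchuk k (r + 1)).natDegree ≤ r + 1 ∧ (kravchuk k (r + 1)).coeff (r + 1) ≠ 0) := by
  induction r with
  | zero => simp [kravchuk]
  | succ r ih =>
    refine ⟨ih.2, ?_, ?_⟩
    · rw [kravchuk]
      refine (natDegree_C_mul_le _ _).trans
        ((natDegree_sub_le_of_le (m := r + 2) (n := r + 2) ?_ ?_).trans (max_self _).le)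
      · exact natDegree_mul_le.trans (by rw [natDegree_X]; have := ih.2.1; omega)
      · exact (natDegree_C_mul_le _ _).trans (by have := ih.1.1; omega)
    · have hr : (r + 2 : ℂ) ≠ 0 := by exact_mod_cast Nat.succ_ne_zero (r + 1)
      have h1 : (kravchuk k r).coeff (r + 2) = 0 :=
        coeff_eq_zero_of_natDegree_lt (by have := ih.1.1; omega)
      rw [kravchuk, Polynomial.coeff_C_mul, Polynomial.coeff_sub, Polynomial.coeff_X_mul,
        Polynomial.coeff_C_mul, h1, mul_zero, sub_zero]
      exact mul_ne_zero (inv_ne_zero hr) ih.2.2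

theorem degree_kravchuk (k : ℂ) (r : ℕ) : (kravchuk k r).degree = r := by
  obtain ⟨h1, h2⟩ := (kravchuk_degree_aux k r).1
  exact le_antisymm (natDegree_le_iff_degree_le.1 h1) (le_degree_of_ne_zero h2)

/-- At argument 0 the recurrence links only indices of equal parity. This is why the conditions say
nothing at the midpoint 2l = k. -/
theorem eval_zero_kravchuk_odd (k : ℂ) (s : ℕ) : (kravchuk k (2 * s + 1)).eval 0 = 0 := by
  induction s with
  | zero => simp [kravchuk]
  | succ s ih =>
    rw [show 2 * (s + 1) + 1 = 2 * s + 1 + 2 by ring, kravchuk]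
    simp [ih]

theorem coeff_X_add_C_pow_mul_X_sub_C_pow (γ : ℂ) (l j r : ℕ) :
    ((Polynomial.X + Polynomial.C γ) ^ l * (Polynomial.X - Polynomial.C γ) ^ j).coeff r =
      γ ^ (l + j - r) * ((-1) ^ j * (kravchuk (l + j : ℂ) r).eval (l - j : ℂ)) := by
  -- Scaling the roots by γ reduces to γ = 1 and also covers γ = 0.
  have h1 : (Polynomial.X + Polynomial.C γ) ^ l * (Polynomial.X - Polynomial.C γ) ^ j =
      ((Polynomial.X + Polynomial.C (1 : ℂ)) ^ l * (Polynomial.X - Polynomial.C 1) ^ j).scaleRoots γ := by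
    rw [mul_scaleRoots_of_noZeroDivisors, pow_scaleRoots_of_isReduced, pow_scaleRoots_of_isReduced,
      X_add_C_scaleRoots, X_sub_C_scaleRoots, one_mul]
  have h2 : ((Polynomial.X + Polynomial.C (1 : ℂ)) ^ l *
      (Polynomial.X - Polynomial.C 1) ^ j).natDegree = l + j := by
    rw [((monic_X_add_C _).pow l).natDegree_mul ((monic_X_sub_C _).pow j), natDegree_pow,
      natDegree_pow, natDegree_X_add_C, natDegree_X_sub_C, mul_one, mul_one]
  have h3 : (Polynomial.X + Polynomial.C (1 : ℂ)) ^ l * (Polynomial.X - Polynomial.C 1) ^ j =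
      Polynomial.C ((-1) ^ j) * ((1 + Polynomial.X) ^ l * (1 - Polynomial.X) ^ j) := by
    rw [show (Polynomial.X - Polynomial.C (1 : ℂ)) = (-1) * (1 - Polynomial.X) by simp, mul_pow]
    simp only [map_one, map_pow, map_neg]
    ring
  rw [h1, coeff_scaleRoots, h2, h3, Polynomial.coeff_C_mul,
    coeff_one_add_X_pow_mul_one_sub_X_pow]
  ring

end Kravchuk

/-! ### Directional derivatives as Taylor coefficients along lines. -/

section DirectionalDerivative

/-- Restriction of a polynomial to the parametrized line `x + t α`. -/
noncomputable def lineRestriction (x α : Fin 2 → ℂ) : MvPolynomial (Fin 2) ℂ →ₐ[ℂ] ℂ[X] :=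
  MvPolynomial.aeval fun i => Polynomial.C (x i) + Polynomial.C (α i) * Polynomial.X

theorem derivative_lineRestriction (x α : Fin 2 → ℂ) (p : MvPolynomial (Fin 2) ℂ) :
    derivative (lineRestriction x α p) = lineRestriction x α (dirDeriv α p) := by
  induction p using MvPolynomial.induction_on with
  | C a => simp [lineRestriction, dirDeriv]
  | add p q hp hq => rw [map_add, map_add, hp, hq, map_add, map_add]
  | mul_X p i hp =>
    have h1 : dirDeriv α (p * MvPolynomial.X i) =
        dirDeriv α p * MvPolynomial.X i + p * MvPolynomial.C (α i) := by
      fin_cases i <;>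
        simp [dirDeriv, Fin.sum_univ_two, pderiv_X, MvPolynomial.smul_eq_C_mul] <;> ring
    rw [h1, map_add, map_mul (lineRestriction x α), map_mul (lineRestriction x α),
      map_mul (lineRestriction x α), derivative_mul, hp]
    simp [lineRestriction, Polynomial.algebraMap_eq]

theorem eval_dirDeriv_pow (x α : Fin 2 → ℂ) (r : ℕ) (p : MvPolynomial (Fin 2) ℂ) :
    MvPolynomial.eval x ((dirDeriv α ^ r) p) =
      (r.factorial : ℂ) * (lineRestriction x α p).coeff r := by
  have h1 : derivative^[r] (lineRestriction x α p) =
      lineRestriction x α ((dirDeriv α ^ r) p) := by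
    induction r with
    | zero => simp
    | succ r ih =>
      rw [Function.iterate_succ_apply', ih, derivative_lineRestriction, pow_succ']
      rfl
  have h2 : ∀ q, (lineRestriction x α q).coeff 0 = MvPolynomial.eval x q := by
    intro q
    rw [Polynomial.coeff_zero_eq_eval_zero]
    induction q using MvPolynomial.induction_on with
    | C a => simp [lineRestriction]
    | add p q hp hq => rw [map_add, Polynomial.eval_add, hp, hq, map_add]
    | mul_X p i hp =>
      rw [map_mul, Polynomial.eval_mul, hp, map_mul]
      simp [lineRestriction]
  rw [← h2, ← h1, coeff_iterate_derivative, zero_add, Nat.descFactorial_self, nsmul_eq_mul]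

end DirectionalDerivative

/-! ### Quasi-invariance in isotropic coordinates. -/

section IsotropicCoordinates

/-- The homogeneous polynomial `∑ c_l u^l v^(k-l)` in the isotropic coordinates
`u = x₁ + i x₂`, `v = x₁ - i x₂`. -/
noncomputable def isotropicForm (k : ℕ) : (Fin (k + 1) → ℂ) →ₗ[ℂ] MvPolynomial (Fin 2) ℂ :=
  Fintype.linearCombination ℂ fun l : Fin (k + 1) =>
    (MvPolynomial.X 0 + MvPolynomial.C Complex.I * MvPolynomial.X 1) ^ (l : ℕ) *
      (MvPolynomial.X 0 - MvPolynomial.C Complex.I * MvPolynomial.X 1) ^ (k - l)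

theorem isotropicForm_apply (k : ℕ) (c : Fin (k + 1) → ℂ) :
    isotropicForm k c = ∑ l, c l •
      ((MvPolynomial.X 0 + MvPolynomial.C Complex.I * MvPolynomial.X 1) ^ (l : ℕ) *
      (MvPolynomial.X 0 - MvPolynomial.C Complex.I * MvPolynomial.X 1) ^ (k - l)) :=
  rfl

theorem isotropicForm_injective (k : ℕ) : Function.Injective (isotropicForm k) := by
  rw [← LinearMap.ker_eq_bot, LinearMap.ker_eq_bot']
  intro c hc
  have h1 : (∑ l : Fin (k + 1), Polynomial.monomial (l : ℕ) (c l) : ℂ[X]) = 0 := by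
    refine Polynomial.funext fun t => ?_
    -- At this point u = t and v = 1.
    have h2 := congrArg (MvPolynomial.eval ![(t + 1) / 2, (t - 1) / (2 * Complex.I)]) hc
    rw [isotropicForm_apply] at h2
    simp only [map_sum, MvPolynomial.smul_eval, map_mul, map_pow, map_add, map_sub,
      MvPolynomial.eval_X, MvPolynomial.eval_C, map_zero, Matrix.cons_val_zero,
      Matrix.cons_val_one] at h2
    have hI := Complex.I_ne_zero
    have e1 : (t + 1) / 2 + Complex.I * ((t - 1) / (2 * Complex.I)) = t := by field_simp; ring
    have e2 : (t + 1) / 2 - Complex.I * ((t - 1) / (2 * Complex.I)) = 1 := by field_simp; ring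
    rw [e1, e2] at h2
    simpa [Polynomial.eval_finsetSum, Polynomial.eval_monomial] using h2
  ext l
  have h3 := congrArg (fun f => Polynomial.coeff f (l : ℕ)) h1
  simpa [Polynomial.finsetSum_coeff, Polynomial.coeff_monomial, Fin.val_inj] using h3

theorem isHomogeneous_isotropicForm (k : ℕ) (c : Fin (k + 1) → ℂ) :
    (isotropicForm k c).IsHomogeneous k := by
  rw [isotropicForm_apply]
  refine MvPolynomial.IsHomogeneous.sum _ _ _ fun l _ => ?_
  rw [MvPolynomial.smul_eq_C_mul]
  have hX : ∀ i : Fin 2, (MvPolynomial.X i : MvPolynomial (Fin 2) ℂ).IsHomogeneous 1 :=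
    fun i => MvPolynomial.isHomogeneous_X _ i
  have h1 := ((hX 0).add ((hX 1).C_mul Complex.I)).pow (l : ℕ)
  have h2 := ((hX 0).sub ((hX 1).C_mul Complex.I)).pow (k - l)
  have h3 := (h1.mul h2).C_mul (c l)
  rwa [one_mul, one_mul, Nat.add_sub_cancel' (Nat.lt_succ_iff.1 l.2)] at h3

theorem exists_sum_of_isHomogeneous {k : ℕ} {q : MvPolynomial (Fin 2) ℂ} (hq : q.IsHomogeneous k) :
    ∃ c : Fin (k + 1) → ℂ,
      q = ∑ l, c l • (MvPolynomial.X 0 ^ (l : ℕ) * MvPolynomial.X 1 ^ (k - l)) := by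
  refine ⟨fun l => q.coeff (Finsupp.single 0 (l : ℕ) + Finsupp.single 1 (k - l)), ?_⟩
  have hmon : ∀ a b : ℕ, (MvPolynomial.X 0 ^ a * MvPolynomial.X 1 ^ b :
      MvPolynomial (Fin 2) ℂ) =
      MvPolynomial.monomial (Finsupp.single 0 a + Finsupp.single 1 b) 1 := by
    intro a b
    rw [MvPolynomial.X_pow_eq_monomial, MvPolynomial.X_pow_eq_monomial,
      MvPolynomial.monomial_mul, one_mul]
  ext d
  simp only [hmon, MvPolynomial.coeff_sum, MvPolynomial.coeff_smul, MvPolynomial.coeff_monomial,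
    smul_eq_mul, mul_ite, mul_one, mul_zero]
  by_cases hd : d 0 + d 1 = k
  · have hd' : d = Finsupp.single 0 (d 0) + Finsupp.single 1 (k - d 0) := by
      ext i
      fin_cases i
      · simp
      · simp; omega
    rw [Finset.sum_eq_single (⟨d 0, by omega⟩ : Fin (k + 1))]
    · simp only
      rw [← hd', if_pos rfl]
    · intro l _ hl
      rw [if_neg]
      intro h
      apply hl
      have := DFunLike.congr_fun h 0
      simp at this
      exact Fin.ext this
    · simp
  · rw [Finset.sum_eq_zero]
    · by_contra hne
      apply hd
      have := hq hne
      rw [Finsupp.weight_apply, Finsupp.sum_fintype _ _ (by simp)] at this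
      simpa using this
    · intro l _
      rw [if_neg]
      rintro rfl
      apply hd
      have := l.2
      simp; omega

theorem range_isotropicForm (k : ℕ) :
    LinearMap.range (isotropicForm k) = homogeneousSubmodule (Fin 2) ℂ k := by
  apply le_antisymm
  · rintro _ ⟨c, rfl⟩
    exact isHomogeneous_isotropicForm k c
  · intro p hp
    have hX : ∀ i : Fin 2, (MvPolynomial.X i : MvPolynomial (Fin 2) ℂ).IsHomogeneous 1 :=
      fun i => MvPolynomial.isHomogeneous_X _ i
    -- `f` writes x₁, x₂ in terms of u, v, and `g` is the inverse substitution.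
    set f : Fin 2 → MvPolynomial (Fin 2) ℂ :=
      ![MvPolynomial.C (1 / 2) * (MvPolynomial.X 0 + MvPolynomial.X 1),
        MvPolynomial.C (1 / (2 * Complex.I)) * (MvPolynomial.X 0 - MvPolynomial.X 1)] with hf
    set g : Fin 2 → MvPolynomial (Fin 2) ℂ :=
      ![MvPolynomial.X 0 + MvPolynomial.C Complex.I * MvPolynomial.X 1,
        MvPolynomial.X 0 - MvPolynomial.C Complex.I * MvPolynomial.X 1] with hg
    have hq : (MvPolynomial.aeval f p).IsHomogeneous k := by
      have := MvPolynomial.IsHomogeneous.aeval (n := 1) hp f (by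
        intro i
        fin_cases i
        · exact ((hX 0).add (hX 1)).C_mul _
        · exact ((hX 0).sub (hX 1)).C_mul _)
      rwa [one_mul] at this
    obtain ⟨c, hc⟩ := exists_sum_of_isHomogeneous hq
    refine ⟨c, ?_⟩
    have hgf : MvPolynomial.aeval g (MvPolynomial.aeval f p) = p := by
      have h1 : (MvPolynomial.aeval g).comp (MvPolynomial.aeval f) = AlgHom.id ℂ _ := by
        have e1 : (MvPolynomial.C (1 / 2) * 2 : MvPolynomial (Fin 2) ℂ) = 1 := by
          rw [← map_ofNat (MvPolynomial.C (σ := Fin 2) (R := ℂ)) 2, ← map_mul]; norm_num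
        have e2 : (MvPolynomial.C (1 / (2 * Complex.I)) * 2 * MvPolynomial.C Complex.I :
            MvPolynomial (Fin 2) ℂ) = 1 := by
          have := Complex.I_ne_zero
          rw [← map_ofNat (MvPolynomial.C (σ := Fin 2) (R := ℂ)) 2, ← map_mul, ← map_mul,
            ← map_one (MvPolynomial.C (σ := Fin 2) (R := ℂ))]
          congr 1
          field_simp
        refine MvPolynomial.algHom_ext fun i => ?_
        fin_cases i
        · simp only [AlgHom.comp_apply, AlgHom.id_apply, MvPolynomial.aeval_X, hf, hg]
          simp only [Fin.zero_eta, Matrix.cons_val_zero, map_mul, map_add, MvPolynomial.aeval_X,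
            MvPolynomial.aeval_C, MvPolynomial.algebraMap_eq, Matrix.cons_val_one]
          linear_combination MvPolynomial.X 0 * e1
        · simp only [AlgHom.comp_apply, AlgHom.id_apply, MvPolynomial.aeval_X, hf, hg]
          simp only [Fin.mk_one, Matrix.cons_val_zero, map_mul, map_sub, MvPolynomial.aeval_X,
            MvPolynomial.aeval_C, MvPolynomial.algebraMap_eq, Matrix.cons_val_one]
          linear_combination MvPolynomial.X 1 * e2
      exact DFunLike.congr_fun h1 p
    rw [← hgf, hc, isotropicForm_apply]
    simp [hg]

/-- The hypotheses make u = a(t + γ) and v = b(t - γ) along x + tα, where a, b are the isotropic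
coordinates of α. -/
theorem coeff_lineRestriction_isotropicForm (α x : Fin 2 → ℂ) (γ : ℂ)
    (hu : x 0 + Complex.I * x 1 = γ * (α 0 + Complex.I * α 1))
    (hv : x 0 - Complex.I * x 1 = -γ * (α 0 - Complex.I * α 1))
    (hb : α 0 - Complex.I * α 1 ≠ 0) (k r : ℕ) (c : Fin (k + 1) → ℂ) :
    (lineRestriction x α (isotropicForm k c)).coeff r =
      γ ^ (k - r) * (-(α 0 - Complex.I * α 1)) ^ k *
        ∑ l : Fin (k + 1), ((-((α 0 + Complex.I * α 1) / (α 0 - Complex.I * α 1))) ^ (l : ℕ) *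
          (kravchuk k r).eval (2 * (l : ℕ) - k : ℂ)) * c l := by
  set a := α 0 + Complex.I * α 1 with ha
  set b := α 0 - Complex.I * α 1 with hb'
  have h1 : lineRestriction x α (MvPolynomial.X 0 + MvPolynomial.C Complex.I * MvPolynomial.X 1) =
      Polynomial.C a * (Polynomial.X + Polynomial.C γ) := by
    have : (Polynomial.C (x 0) + Polynomial.C Complex.I * Polynomial.C (x 1) : ℂ[X]) =
        Polynomial.C γ * Polynomial.C a := by
      rw [← map_mul, ← map_mul, ← map_add, hu]
    simp only [lineRestriction, map_add, map_mul, MvPolynomial.aeval_X, MvPolynomial.aeval_C,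
      Polynomial.algebraMap_eq]
    simp only [ha, map_add, map_mul] at this ⊢
    linear_combination this
  have h2 : lineRestriction x α (MvPolynomial.X 0 - MvPolynomial.C Complex.I * MvPolynomial.X 1) =
      Polynomial.C b * (Polynomial.X - Polynomial.C γ) := by
    have : (Polynomial.C (x 0) - Polynomial.C Complex.I * Polynomial.C (x 1) : ℂ[X]) =
        -Polynomial.C γ * Polynomial.C b := by
      rw [← map_neg, ← map_mul, ← map_mul, ← map_sub, hv]
    simp only [lineRestriction, map_sub, map_mul, MvPolynomial.aeval_X, MvPolynomial.aeval_C,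
      Polynomial.algebraMap_eq]
    simp only [hb', map_sub, map_mul] at this ⊢
    linear_combination this
  rw [isotropicForm_apply, map_sum, Polynomial.finsetSum_coeff, Finset.mul_sum]
  refine Finset.sum_congr rfl fun l _ => ?_
  have hl : (l : ℕ) + (k - l) = k := Nat.add_sub_cancel' (Nat.lt_succ_iff.1 l.2)
  have hl' : ((k - l : ℕ) : ℂ) = k - (l : ℕ) := Nat.cast_sub (Nat.lt_succ_iff.1 l.2)
  rw [map_smul, map_mul, map_pow, map_pow, h1, h2, Polynomial.coeff_smul, smul_eq_mul, mul_pow,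
    mul_pow, mul_mul_mul_comm, ← map_pow, ← map_pow, ← map_mul, Polynomial.coeff_C_mul,
    coeff_X_add_C_pow_mul_X_sub_C_pow, hl, hl',
    show ((l : ℕ) : ℂ) + (k - (l : ℕ)) = k by ring,
    show ((l : ℕ) : ℂ) - (k - (l : ℕ)) = 2 * (l : ℕ) - k by ring]
  have h3 : (-b) ^ k * (-(a / b)) ^ (l : ℕ) = a ^ (l : ℕ) * b ^ (k - l) * (-1) ^ (k - l) := by
    have h4 : (-b) ^ k = (-b) ^ (l : ℕ) * (-b) ^ (k - l) := by rw [← pow_add, hl]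
    rw [h4, mul_right_comm, ← mul_pow, show -b * -(a / b) = a by field_simp, neg_pow b]
    ring
  linear_combination (-(c l) * γ ^ (k - r) *
    (kravchuk k r).eval (2 * (l : ℕ) - k : ℂ)) * h3

/-- The point x on the orthogonal line enters only through a power of γ, so each condition is a
single linear equation; the test point used below has γ = 1. -/
theorem dirDeriv_pow_vanishes_iff (α : Fin 2 → ℂ) (hα : α ⬝ᵥ α ≠ 0) (k r : ℕ)
    (c : Fin (k + 1) → ℂ) :
    (∀ x : Fin 2 → ℂ, α ⬝ᵥ x = 0 →
      MvPolynomial.eval x ((dirDeriv α ^ r) (isotropicForm k c)) = 0) ↔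
    ∑ l : Fin (k + 1), ((-((α 0 + Complex.I * α 1) / (α 0 - Complex.I * α 1))) ^ (l : ℕ) *
      (kravchuk k r).eval (2 * (l : ℕ) - k : ℂ)) * c l = 0 := by
  have hab : (α 0 + Complex.I * α 1) * (α 0 - Complex.I * α 1) ≠ 0 := by
    rw [Matrix.vec2_dotProduct] at hα
    convert hα using 1
    linear_combination (-(α 1) ^ 2) * Complex.I_sq
  have ha := left_ne_zero_of_mul hab
  have hb := right_ne_zero_of_mul hab
  constructor
  · intro h
    have h1 := h ![Complex.I * α 1, -Complex.I * α 0] (by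
      rw [Matrix.vec2_dotProduct]; simp; ring)
    rw [eval_dirDeriv_pow, coeff_lineRestriction_isotropicForm α _ 1
      (by simp; linear_combination (-(α 0)) * Complex.I_sq)
      (by simp; linear_combination ((α 0)) * Complex.I_sq) hb] at h1
    have hf : (r.factorial : ℂ) ≠ 0 := by exact_mod_cast r.factorial_ne_zero
    rcases mul_eq_zero.1 h1 with h2 | h2
    · exact absurd h2 hf
    · refine (mul_eq_zero.1 h2).resolve_left ?_
      rw [one_pow, one_mul]
      exact pow_ne_zero _ (neg_ne_zero.2 hb)
  · intro h x hx
    rw [Matrix.vec2_dotProduct] at hx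
    set γ := (x 0 + Complex.I * x 1) / (α 0 + Complex.I * α 1) with hγ
    have hu : x 0 + Complex.I * x 1 = γ * (α 0 + Complex.I * α 1) := by
      rw [hγ, div_mul_cancel₀ _ ha]
    have hv : x 0 - Complex.I * x 1 = -γ * (α 0 - Complex.I * α 1) := by
      apply mul_left_cancel₀ ha
      linear_combination 2 * hx - (α 0 - Complex.I * α 1) * hu -
        2 * α 1 * x 1 * Complex.I_sq
    rw [eval_dirDeriv_pow, coeff_lineRestriction_isotropicForm α x γ hu hv hb, h, mul_zero,
      mul_zero]

end IsotropicCoordinates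

/-! ### Rank of the quasi-invariance conditions. -/

section ConditionMatrix

/-- The parameter `-(α₁ + i α₂) / (α₁ - i α₂)` of the line orthogonal to `α`. -/
noncomputable def normalRatio (α : Fin 2 → ℂ) : ℂ :=
  -((α 0 + Complex.I * α 1) / (α 0 - Complex.I * α 1))

theorem isotropic_coords_ne_zero {α : Fin 2 → ℂ} (hα : α ⬝ᵥ α ≠ 0) :
    α 0 + Complex.I * α 1 ≠ 0 ∧ α 0 - Complex.I * α 1 ≠ 0 := by
  have hab : (α 0 + Complex.I * α 1) * (α 0 - Complex.I * α 1) ≠ 0 := by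
    rw [Matrix.vec2_dotProduct] at hα
    convert hα using 1
    linear_combination (-(α 1) ^ 2) * Complex.I_sq
  exact ⟨left_ne_zero_of_mul hab, right_ne_zero_of_mul hab⟩

theorem normalRatio_ne_zero {α : Fin 2 → ℂ} (hα : α ⬝ᵥ α ≠ 0) : normalRatio α ≠ 0 :=
  neg_ne_zero.2 (div_ne_zero (isotropic_coords_ne_zero hα).1 (isotropic_coords_ne_zero hα).2)

theorem normalRatio_ne {α β : Fin 2 → ℂ} (hα : α ⬝ᵥ α ≠ 0) (hβ : β ⬝ᵥ β ≠ 0)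
    (h : LinearIndependent ℂ ![α, β]) : normalRatio α ≠ normalRatio β := by
  intro he
  obtain ⟨ha, hb⟩ := isotropic_coords_ne_zero hα
  obtain ⟨hc, hd⟩ := isotropic_coords_ne_zero hβ
  rw [normalRatio, normalRatio, neg_inj, div_eq_div_iff hb hd] at he
  have h1 : α 0 * β 1 = α 1 * β 0 := by
    have h2 : (2 * Complex.I) * (α 0 * β 1) = (2 * Complex.I) * (α 1 * β 0) := by
      linear_combination -he
    exact mul_left_cancel₀ (mul_ne_zero two_ne_zero Complex.I_ne_zero) h2
  rw [LinearIndependent.pair_iff] at h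
  have h3 := h (β 0) (-α 0) (by
    ext i
    fin_cases i
    · simp; ring
    · simp; linear_combination -h1)
  have h4 := h (β 1) (-α 1) (by
    ext i
    fin_cases i
    · simp; linear_combination h1
    · simp; ring)
  apply ha
  rw [neg_eq_zero.1 h3.2, neg_eq_zero.1 h4.2]
  ring

variable {n : ℕ}

/-- The matrix of the quasi-invariance conditions in degree `k`. -/
noncomputable def Configuration.conditionMatrix (A : Configuration n) (m k : ℕ) :
    Matrix (Fin m ⊕ Fin n) (Fin (k + 1)) ℂ :=
  Matrix.of fun i l => Sum.elim
    (fun s : Fin m => normalRatio (A.vec 0) ^ (l : ℕ) *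
      (kravchuk k (2 * s + 1)).eval (2 * (l : ℕ) - k : ℂ))
    (fun j : Fin n => normalRatio (A.vec j.succ) ^ (l : ℕ) *
      (kravchuk k 1).eval (2 * (l : ℕ) - k : ℂ)) i

theorem Configuration.isQuasiInvariant_isotropicForm_iff (A : Configuration n) {m : ℕ}
    (hA : A.HasType m) (k : ℕ) (c : Fin (k + 1) → ℂ) :
    A.IsQuasiInvariant (isotropicForm k c) ↔ A.conditionMatrix m k *ᵥ c = 0 := by
  have key := fun i r => dirDeriv_pow_vanishes_iff (A.vec i) (A.nonisotropic i) k r c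
  constructor
  · intro h
    ext i
    rcases i with s | j
    · exact (key 0 (2 * s + 1)).1 (h 0 (s + 1) (by omega) (by rw [hA.1]; exact s.2))
    · exact (key j.succ 1).1 (h j.succ 1 le_rfl (by rw [hA.2]))
  · intro h i s hs1 hs2
    obtain ⟨s, rfl⟩ : ∃ t, s = t + 1 := ⟨s - 1, by omega⟩
    rw [key]
    induction i using Fin.cases with
    | zero =>
      rw [hA.1] at hs2
      exact congrFun h (Sum.inl ⟨s, hs2⟩)
    | succ j =>
      rw [hA.2] at hs2
      obtain rfl : s = 0 := by omega
      exact congrFun h (Sum.inr j)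

/-- `isotropicForm` identifies the space with the kernel of the matrix; apply rank-nullity. -/
theorem Configuration.finrank_add_rank (A : Configuration n) {m : ℕ} (hA : A.HasType m) (k : ℕ) :
    Module.finrank ℂ ↥(A.quasiInvariants ⊓ homogeneousSubmodule (Fin 2) ℂ k) +
      (A.conditionMatrix m k).rank = k + 1 := by
  have h1 : A.quasiInvariants ⊓ homogeneousSubmodule (Fin 2) ℂ k =
      (LinearMap.ker (A.conditionMatrix m k).mulVecLin).map (isotropicForm k) := by
    ext p
    rw [← range_isotropicForm, Submodule.mem_inf, Submodule.mem_map]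
    constructor
    · rintro ⟨hp, c, rfl⟩
      exact ⟨c, (A.isQuasiInvariant_isotropicForm_iff hA k c).1 hp, rfl⟩
    · rintro ⟨c, hc, rfl⟩
      exact ⟨(A.isQuasiInvariant_isotropicForm_iff hA k c).2 hc, c, rfl⟩
  have h2 := (Submodule.equivMapOfInjective (isotropicForm k) (isotropicForm_injective k)
    (LinearMap.ker (A.conditionMatrix m k).mulVecLin)).finrank_eq
  rw [h1, ← h2, Matrix.rank, add_comm, LinearMap.finrank_range_add_finrank_ker,
    Module.finrank_fin_fun]

/-- A linear dependency between the quasi-invariance conditions is an exponential polynomial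
vanishing at all integers of an interval, except possibly its midpoint. -/
theorem Configuration.exists_exponential_of_dependent (A : Configuration n) {m k : ℕ}
    (hm : 1 ≤ m)
    (h : ¬ LinearIndependent ℂ (A.conditionMatrix m k).row) :
    ∃ (E : ℂ[X]) (B : Fin n → ℂ), E.natDegree < 2 * m - 1 ∧ (E ≠ 0 ∨ ∃ j, B j ≠ 0) ∧
      ∀ l ≤ k, 2 * l ≠ k → E.eval (l : ℂ) +
        ∑ j, B j * (normalRatio (A.vec j.succ) / normalRatio (A.vec 0)) ^ l = 0 := by
  obtain ⟨g, hg, i, hi⟩ := Fintype.not_linearIndependent_iff.1 h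
  set w := normalRatio (A.vec 0) with hw
  have hw0 : w ≠ 0 := normalRatio_ne_zero (A.nonisotropic 0)
  -- `F` is the contribution of α_0 as a polynomial in 2l - k. It vanishes at 0, and the simple
  -- vectors contribute multiples of K_1 = X, so the whole relation can be divided by 2l - k.
  set F : ℂ[X] := ∑ s : Fin m, Polynomial.C (g (Sum.inl s)) * kravchuk k (2 * s + 1) with hF
  have hFdeg : F.natDegree ≤ 2 * m - 1 := by
    refine natDegree_sum_le_of_forall_le _ _ fun s _ => (natDegree_C_mul_le _ _).trans ?_
    rw [natDegree_eq_of_degree_eq_some (degree_kravchuk k (2 * s + 1))]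
    have := s.2
    omega
  have hF0 : F.eval 0 = 0 := by
    rw [hF, Polynomial.eval_finsetSum]
    exact Finset.sum_eq_zero fun s _ => by
      rw [Polynomial.eval_mul, eval_zero_kravchuk_odd, mul_zero]
  obtain ⟨E, hE⟩ : Polynomial.X ∣ F := by
    rw [Polynomial.X_dvd_iff, Polynomial.coeff_zero_eq_eval_zero, hF0]
  set T : ℂ[X] := Polynomial.C 2 * Polynomial.X + Polynomial.C (-k : ℂ) with hT
  have hTdeg : T.natDegree = 1 := natDegree_linear two_ne_zero
  refine ⟨E.comp T, fun j => g (Sum.inr j), ?_, ?_, ?_⟩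
  · rw [natDegree_comp, hTdeg, mul_one]
    by_cases hE0 : E = 0
    · rw [hE0, natDegree_zero]; omega
    · rw [hE, natDegree_X_mul hE0] at hFdeg
      omega
  · by_contra! hcon
    obtain ⟨hET, hB⟩ := hcon
    have hE0 : E = 0 := by
      rcases comp_eq_zero_iff.1 hET with h | ⟨_, h⟩
      · exact h
      · rw [h, natDegree_C] at hTdeg
        omega
    rw [hE0, mul_zero] at hE
    rcases i with s | j
    -- The Kravchuk polynomials in `F` have distinct degrees, so no nontrivial combination of them
    -- vanishes.
    · have hdis := degree_sum_eq_of_disjoint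
        (fun s : Fin m => Polynomial.C (g (Sum.inl s)) * kravchuk k (2 * s + 1)) Finset.univ (by
          rintro s ⟨_, hs⟩ t ⟨_, ht⟩ hst
          show degree _ ≠ degree _
          rw [degree_C_mul (by rintro h0; simp [h0] at hs), degree_kravchuk,
            degree_C_mul (by rintro h0; simp [h0] at ht), degree_kravchuk]
          intro h0
          apply hst
          have h1 : (2 * s + 1 : ℕ) = 2 * t + 1 := by exact_mod_cast h0
          exact Fin.ext (by omega))
      rw [← hF, hE, degree_zero, eq_comm, Finset.sup_eq_bot_iff] at hdis
      have h1 := hdis s (Finset.mem_univ s)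
      rw [degree_C_mul hi, degree_kravchuk] at h1
      exact absurd h1 (WithBot.natCast_ne_bot _)
    · exact hi (hB j)
  · intro l hl hlk
    have h1 := congrFun hg ⟨l, Nat.lt_succ_iff.2 hl⟩
    simp only [Finset.sum_apply, Pi.smul_apply, Fintype.sum_sum_type, Matrix.row,
      Configuration.conditionMatrix, Matrix.of_apply, Sum.elim_inl, Sum.elim_inr, smul_eq_mul,
      Pi.zero_apply, kravchuk, Polynomial.eval_X, ← hw] at h1
    have hd : (2 * l - k : ℂ) ≠ 0 := by
      rw [sub_ne_zero]
      exact_mod_cast hlk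
    have h2 : F.eval (2 * l - k : ℂ) = (2 * l - k) * E.eval (2 * l - k : ℂ) := by
      rw [hE, Polynomial.eval_mul, Polynomial.eval_X]
    rw [hF, Polynomial.eval_finsetSum] at h2
    simp only [Polynomial.eval_mul, Polynomial.eval_C] at h2
    have h3 : (E.comp T).eval (l : ℂ) = E.eval (2 * l - k : ℂ) := by
      rw [Polynomial.eval_comp, hT]
      simp [sub_eq_add_neg]
    rw [h3]
    apply mul_left_cancel₀ (mul_ne_zero hd (pow_ne_zero l hw0))
    rw [mul_zero, ← h1, mul_add, mul_right_comm, ← h2, Finset.sum_mul, Finset.mul_sum]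
    congr 1
    · exact Finset.sum_congr rfl fun s _ => by ring
    · refine Finset.sum_congr rfl fun j _ => ?_
      rw [div_pow]
      field_simp

theorem Configuration.ratio_properties (A : Configuration n) :
    (Function.Injective fun j : Fin n =>
        normalRatio (A.vec j.succ) / normalRatio (A.vec 0)) ∧
      (∀ j : Fin n, normalRatio (A.vec j.succ) / normalRatio (A.vec 0) ≠ 0) ∧
      ∀ j : Fin n, normalRatio (A.vec j.succ) / normalRatio (A.vec 0) ≠ 1 := by
  have hw0 := fun i => normalRatio_ne_zero (A.nonisotropic i)
  have hne : ∀ i j, i ≠ j → normalRatio (A.vec i) ≠ normalRatio (A.vec j) := fun i j hij =>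
    normalRatio_ne (A.nonisotropic i) (A.nonisotropic j) (A.noncollinear i j hij)
  refine ⟨fun i j hij => ?_, fun j => div_ne_zero (hw0 _) (hw0 _), fun j h => ?_⟩
  · by_contra hcon
    exact hne i.succ j.succ (fun h => hcon (Fin.succ_injective _ h))
      ((div_left_inj' (hw0 0)).1 hij)
  · exact hne j.succ 0 (Fin.succ_ne_zero j) ((div_eq_one_iff_eq (hw0 0)).1 h)

/-- In such degrees the exponents above the midpoint contain an unbroken interval of length 2m - 1 +
n, on which no nontrivial E + ∑ B_j z_j^l can vanish. -/
theorem Configuration.linearIndependent_conditionMatrix (A : Configuration n) {m k : ℕ}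
    (hm : 1 ≤ m) (hk : 2 * (2 * m + n) ≤ k) :
    LinearIndependent ℂ (A.conditionMatrix m k).row := by
  by_contra h
  obtain ⟨E, B, hE, hne, hzero⟩ := A.exists_exponential_of_dependent hm h
  obtain ⟨hinj, h0, h1⟩ := A.ratio_properties
  have hz : ∀ l, k / 2 + 1 ≤ l → l < k / 2 + 1 + (2 * m - 1 + n) → E.eval (l : ℂ) +
      ∑ j, B j * (normalRatio (A.vec j.succ) / normalRatio (A.vec 0)) ^ l = 0 :=
    fun l hl hl' => hzero l (by omega) (by omega)
  rcases hne with hne | ⟨j, hj⟩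
  · exact hne (exponential_poly_eq_zero _ E B _ hE hinj h0 h1 le_rfl hz)
  · exact hj (exponential_coeff_eq_zero _ E B _ hE hinj h0 h1 le_rfl hz j)

theorem Configuration.coeff_prod_of_isGorenstein (A : Configuration n) {m : ℕ} (hm : 1 ≤ m)
    (hA : A.HasType m) (hG : A.IsGorenstein) (i : ℕ) (hi : i ≤ n) :
    (∏ j : Fin n, (Polynomial.X -
      Polynomial.C (normalRatio (A.vec j.succ) / normalRatio (A.vec 0)))).coeff (n - i) =
      (n.choose i : ℂ) * ((m + i - 1).choose i : ℂ) * ((m + n - 1).choose i : ℂ)⁻¹ := by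
  obtain ⟨N, D, M, hD, hP, hsymm⟩ := hG
  set b : ℕ → ℕ := fun k =>
    Module.finrank ℂ ↥(A.quasiInvariants ⊓ homogeneousSubmodule (Fin 2) ℂ k) with hb
  have hrank : ∀ k, b k + (A.conditionMatrix m k).rank = k + 1 := A.finrank_add_rank hA
  have hlarge : ∀ k, 2 * (2 * m + n) ≤ k → (b k : ℚ) = k + 1 - (m + n : ℕ) := by
    intro k hk
    have h1 := (A.linearIndependent_conditionMatrix hm hk).rank_matrix
    rw [Fintype.card_sum, Fintype.card_fin, Fintype.card_fin] at h1
    have h2 := hrank k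
    rw [h1] at h2
    rw [eq_sub_iff_add_eq]
    exact_mod_cast h2
  have hzero : b 0 = 1 := by
    have h1 : A.conditionMatrix m 0 = 0 := by
      ext i l
      rcases i with s | j
      · simp [Configuration.conditionMatrix, eval_zero_kravchuk_odd]
      · simp [Configuration.conditionMatrix, kravchuk]
    have h2 := hrank 0
    rwa [h1, Matrix.rank_zero, add_zero, zero_add] at h2
  have hmid := hilbertFunction_of_symmetric (fun k => (b k : ℚ)) (m + n) (by omega)
    (2 * (2 * m + n)) hlarge (by simp [hzero]) N D M hD hP hsymm
  have hmid' : b (2 * (m + n) - 2) = m + n := by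
    simp only [hzero, Nat.cast_one, sub_add_cancel] at hmid
    exact_mod_cast hmid
  obtain ⟨hinj, h0, h1⟩ := A.ratio_properties
  rcases Nat.eq_zero_or_pos n with rfl | hn
  · obtain rfl : i = 0 := by omega
    simp
  -- Full rank m + n would leave dimension m + n - 1, but the symmetry gives m + n.
  have hdep : ¬ LinearIndependent ℂ (A.conditionMatrix m (2 * (m + n) - 2)).row := by
    intro h
    have h2 := h.rank_matrix
    rw [Fintype.card_sum, Fintype.card_fin, Fintype.card_fin] at h2
    have h3 := hrank (2 * (m + n) - 2)
    rw [h2, hmid'] at h3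
    omega
  obtain ⟨E, B, hE, hne, hvan⟩ := A.exists_exponential_of_dependent hm hdep
  exact coeff_prod_of_exponential_eq_zero m n hm E B _ hE hinj h0 h1 hne
    (fun l hl hl' => hvan l (by omega) (by omega)) i hi

end ConditionMatrix

/-! ### Normalization by an orthogonal transformation. -/

section StandardForm

/-- Up to scale, a non-isotropic vector is determined by the quotient of its isotropic coordinates;
those of (cos φ, sin φ) are exp(±iφ). -/
theorem exists_smul_eq_cos_sin (β : Fin 2 → ℂ) (φ : ℂ) (ha : β 0 + Complex.I * β 1 ≠ 0)
    (hb : β 0 - Complex.I * β 1 ≠ 0) (h : Complex.exp (2 * Complex.I * φ) =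
      (β 0 + Complex.I * β 1) / (β 0 - Complex.I * β 1)) :
    ∃ c : ℂ, c ≠ 0 ∧ c • β = ![Complex.cos φ, Complex.sin φ] := by
  have h1 : Complex.exp (2 * Complex.I * φ) = Complex.exp (φ * Complex.I) ^ 2 := by
    rw [← Complex.exp_nat_mul]
    congr 1
    push_cast; ring
  set e := Complex.exp (φ * Complex.I) with he
  have he0 : e ≠ 0 := Complex.exp_ne_zero _
  have hc : Complex.cos φ + Complex.sin φ * Complex.I = e := (Complex.exp_mul_I φ).symm
  have hs : Complex.cos φ - Complex.sin φ * Complex.I = e⁻¹ := by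
    rw [he, ← Complex.exp_neg, ← neg_mul, Complex.exp_mul_I, Complex.cos_neg, Complex.sin_neg]
    ring
  rw [h1, eq_div_iff hb] at h
  set c := e / (β 0 + Complex.I * β 1) with hcdef
  have hca : c * (β 0 + Complex.I * β 1) = e := div_mul_cancel₀ _ ha
  have hcb : c * (β 0 - Complex.I * β 1) = e⁻¹ := by
    rw [hcdef, ← h]
    field_simp
  refine ⟨c, div_ne_zero he0 ha, ?_⟩
  ext i
  fin_cases i
  · simp only [Fin.zero_eta, Pi.smul_apply, smul_eq_mul, Matrix.cons_val_zero]
    linear_combination (hca + hcb - hc - hs) / 2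
  · simp only [Fin.mk_one, Pi.smul_apply, smul_eq_mul, Matrix.cons_val_one,
      Matrix.cons_val_fin_one]
    apply mul_left_cancel₀ (mul_ne_zero two_ne_zero Complex.I_ne_zero)
    linear_combination hca - hcb - hc + hs

variable {n : ℕ}

/-- The image of a configuration under an orthogonal transformation and rescaling. -/
noncomputable def Configuration.transform (A : Configuration n) (O : Matrix (Fin 2) (Fin 2) ℂ)
    (hO : Oᵀ * O = 1) (c : Fin (n + 1) → ℂ) (hc : ∀ i, c i ≠ 0) : Configuration n where
  vec i := c i • (O *ᵥ A.vec i)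
  mult := A.mult
  mult_pos := A.mult_pos
  nonisotropic i := by
    rw [smul_dotProduct, dotProduct_smul, Matrix.dotProduct_mulVec, Matrix.vecMul_mulVec, hO,
      Matrix.vecMul_one]
    exact mul_ne_zero (hc i) (mul_ne_zero (hc i) (A.nonisotropic i))
  noncollinear i j hij := by
    have h := LinearIndependent.pair_iff.1 (A.noncollinear i j hij)
    refine LinearIndependent.pair_iff.2 fun s t hst => ?_
    have h1 := congrArg (fun v => Oᵀ *ᵥ v) hst
    simp only [Matrix.mulVec_add, Matrix.mulVec_smul, Matrix.mulVec_mulVec, hO, Matrix.one_mulVec,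
      Matrix.mulVec_zero, smul_smul] at h1
    obtain ⟨h2, h3⟩ := h _ _ h1
    exact ⟨(mul_eq_zero.1 h2).resolve_right (hc i), (mul_eq_zero.1 h3).resolve_right (hc j)⟩

/-- A rotation multiplies u and v by mutually inverse constants, so it preserves the ratios z_j.
Once α_0 is (1, 0), w_0 = -1 and w_j = -exp(2iφ_j). -/
theorem Configuration.exists_standard_of_coeff_prod (A : Configuration n) {m : ℕ}
    (hA : A.HasType m)
    (h : ∀ i, i ≤ n → (∏ j : Fin n, (Polynomial.X -
      Polynomial.C (normalRatio (A.vec j.succ) / normalRatio (A.vec 0)))).coeff (n - i) =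
      (n.choose i : ℂ) * ((m + i - 1).choose i : ℂ) * ((m + n - 1).choose i : ℂ)⁻¹) :
    ∃ B : Configuration n, B.IsStandard m ∧ A.Equivalent B := by
  obtain ⟨_, hz0, _⟩ := A.ratio_properties
  set z : Fin n → ℂ := fun j => normalRatio (A.vec j.succ) / normalRatio (A.vec 0) with hz
  have hφ : ∀ j, ∃ φ : ℂ, Complex.exp (2 * Complex.I * φ) = z j := by
    intro j
    refine ⟨Complex.log (z j) / (2 * Complex.I), ?_⟩
    rw [mul_div_cancel₀ _ (mul_ne_zero two_ne_zero Complex.I_ne_zero), Complex.exp_log (hz0 j)]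
  choose φ hφ using hφ
  obtain ⟨d, hd⟩ := IsAlgClosed.exists_pow_nat_eq (A.vec 0 ⬝ᵥ A.vec 0) (n := 2) two_pos
  have hd0 : d ≠ 0 := by
    rintro rfl
    exact A.nonisotropic 0 (by rw [← hd]; ring)
  rw [Matrix.vec2_dotProduct] at hd
  have hiso := fun i => isotropic_coords_ne_zero (A.nonisotropic i)
  have hiso0 := hiso 0
  set p := A.vec 0 0 with hp
  set q := A.vec 0 1 with hq
  -- This rotation sends α_0 to (d, 0), where d² = (α_0, α_0); hence the scalar 1 / d for α_0.
  set O : Matrix (Fin 2) (Fin 2) ℂ := !![p / d, q / d; -q / d, p / d] with hO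
  have h1 : p / d * (p / d) + q / d * (q / d) = 1 := by
    field_simp
    linear_combination -hd
  have hOO : Oᵀ * O = 1 := by
    ext i j
    fin_cases i <;> fin_cases j <;> simp [hO, Matrix.mul_apply, Fin.sum_univ_two]
    · linear_combination h1
    · ring
    · ring
    · linear_combination h1
  have hO0 : ∀ α : Fin 2 → ℂ, (O *ᵥ α) 0 = p / d * α 0 + q / d * α 1 := fun α => by
    simp [hO, Matrix.mulVec, dotProduct, Fin.sum_univ_two]
  have hO1 : ∀ α : Fin 2 → ℂ, (O *ᵥ α) 1 = -q / d * α 0 + p / d * α 1 := fun α => by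
    simp [hO, Matrix.mulVec, dotProduct, Fin.sum_univ_two]
  have hplus : ∀ α : Fin 2 → ℂ, (O *ᵥ α) 0 + Complex.I * (O *ᵥ α) 1 =
      (p - Complex.I * q) / d * (α 0 + Complex.I * α 1) := fun α => by
    rw [hO0, hO1]
    field_simp
    linear_combination (q * α 1) * Complex.I_sq
  have hminus : ∀ α : Fin 2 → ℂ, (O *ᵥ α) 0 - Complex.I * (O *ᵥ α) 1 =
      (p + Complex.I * q) / d * (α 0 - Complex.I * α 1) := fun α => by
    rw [hO0, hO1]
    field_simp
    linear_combination (q * α 1) * Complex.I_sq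
  have hc : ∀ j : Fin n, ∃ c : ℂ, c ≠ 0 ∧
      c • (O *ᵥ A.vec j.succ) = ![Complex.cos (φ j), Complex.sin (φ j)] := by
    intro j
    obtain ⟨ha, hb⟩ := hiso j.succ
    apply exists_smul_eq_cos_sin
    · rw [hplus]
      exact mul_ne_zero (div_ne_zero hiso0.2 hd0) ha
    · rw [hminus]
      exact mul_ne_zero (div_ne_zero hiso0.1 hd0) hb
    · rw [hplus, hminus, hφ, hz]
      simp only [normalRatio, ← hp, ← hq]
      have h2 := hiso0.1
      have h3 := hiso0.2
      field_simp
  choose c hc0 hc using hc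
  have hcons : ∀ i, (Fin.cons (1 / d) c : Fin (n + 1) → ℂ) i ≠ 0 :=
    Fin.cases (by simpa using hd0) (by simpa using hc0)
  refine ⟨A.transform O hOO (Fin.cons (1 / d) c) hcons, ⟨hA, ?_, φ, ?_, ?_⟩,
    Equiv.refl _, O, Fin.cons (1 / d) c, hOO, fun i => ⟨hcons i, rfl, rfl⟩⟩
  · show (Fin.cons (1 / d) c : Fin (n + 1) → ℂ) 0 • (O *ᵥ A.vec 0) = ![1, 0]
    ext i
    fin_cases i
    · simp only [Fin.zero_eta, Pi.smul_apply, Fin.cons_zero, hO0, smul_eq_mul,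
        Matrix.cons_val_zero, ← hp, ← hq]
      field_simp
      linear_combination -hd
    · simp only [Fin.mk_one, Pi.smul_apply, Fin.cons_zero, hO1, smul_eq_mul,
        Matrix.cons_val_one, Matrix.cons_val_fin_one, ← hp, ← hq]
      ring
  · intro j
    exact hc j
  · intro i _ hi
    have h2 := h i hi
    have h3 : (∏ j : Fin n, (Polynomial.X - Polynomial.C (z j))) =
        ((Finset.univ.val.map z).map fun t => Polynomial.X - Polynomial.C t).prod := by
      rw [Multiset.map_map]; rfl
    have hcard : Multiset.card ((Finset.univ : Finset (Fin n)).val.map z) = n := by simp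
    rw [h3, Multiset.prod_X_sub_C_coeff _ (by rw [hcard]; omega), hcard,
      Nat.sub_sub_self hi] at h2
    simp_rw [hφ]
    have h4 : ((-1 : ℂ) ^ i) * (-1) ^ i = 1 := by rw [← mul_pow]; simp
    calc _ = ((-1 : ℂ) ^ i * (-1) ^ i) * (Finset.univ.val.map z).esymm i := by
          rw [h4, one_mul]
      _ = _ := by rw [mul_assoc, h2]; ring

end StandardForm

theorem theorem6p6 (m n : ℕ) (hm : 1 ≤ m) (hn : 1 ≤ n) (A : Configuration n)
    (hA : A.HasType m) (hG : A.IsGorenstein) :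
    ∃ B : Configuration n, B.IsStandard m ∧ A.Equivalent B :=
  A.exists_standard_of_coeff_prod hA (A.coeff_prod_of_isGorenstein hm hA hG)
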